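/- All systems are finite-dimensional, identified with $\mathbb{C}^n$ carrying its standard basis; operators are complex matrices and $\leq$ is the Loewner order. A state is a positive semi-definite operator of trace one; a channel is a completely positive trace-preserving linear map. $T_X$ denotes the (partial) transpose on system $X$ in the standard basis. For linear maps $\mathcal{N},\mathcal{M}$ from operators on $C$ to operators on $D$, put $$\|\mathcal{N}-\mathcal{M}\|_\diamond=\sup_{R,\ \rho_{RC}}\big\|(\mathrm{id}_R\otimes\mathcal{N})(\rho_{RC})-(\mathrm{id}_R\otimes\mathcal{M})(\rho_{RC})\big\|_1,$$ the supremum being over all finite-dimensional reference systems $R$ and all states $\rho_{RC}$, with $\|X\|_1=\operatorname{Tr}\sqrt{X^\dagger X}$; and let $\Gamma^{\mathcal{N}}_{CD}=\sum_{i,j}|i\rangle\langle j|\otimes\mathcal{N}(|i\rangle\langle j|)$ be the Choi operator of $\mathcal{N}$. A bipartite channel $\mathcal{P}_{AB\to A'B'}$ is C-PPT-P if $T_{B'}\circ\mathcal{P}\circ T_B$ is completely positive. For a bipartite channel $\mathcal{N}_{AB\to A'B'}$ and a bipartite resource state $\rho_{\hat A\hat B}$, define the simulation error $$e_{\mathrm{PPT}}(\mathcal{N},\rho_{\hat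 A\hat B})=\frac12\inf_{\mathcal{P}}\big\|\mathcal{N}-\widetilde{\mathcal{N}}\big\|_\diamond,\qquad \widetilde{\mathcal{N}}(\omega_{AB})=\mathcal{P}(\omega_{AB}\otimes\rho_{\hat A\hat B}),$$ where the infimum is over all C-PPT-P channels $\mathcal{P}_{AB\hat A\hat B\to A'B'}$ (Alice holds $A\hat A$, Bob holds $B\hat B$; that is, $T_{B'}\circ\mathcal{P}\circ T_{B\hat B}$ is completely positive). Define also $v_{\mathrm{PPT}}(\mathcal{N},\rho_{\hat A\hat B})$ as the optimal value of the semi-definite program $$\inf\ \mu\quad\text{over}\quad \mu\geq0,\ Z_{ABA'B'}\geq0,\ P_{AB\hat A\hat BA'B'}\geq0$$ subject to $\operatorname{Tr}_{A'B'}[Z_{ABA'B'}]\leq\mu I_{AB}$, $T_{B\hat BB'}(P)\geq0$, $\operatorname{Tr}_{A'B'}[P]=I_{AB\hat A\hat B}$ and $Z_{ABA'B'}\geq\Gamma^{\mathcal{N}}_{ABA'B'}-\operatorname{Tr}_{\hat A\hat B}[T_{\hat A\hat B}(\rho_{\hat A\hat B})P]$. **Proposition.** Let $d\geq2$, let $A,B$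 have dimension $d$, let $F_{AB}=\sum_{i,j=0}^{d-1}|i\rangle\langle j|_A\otimes|j\rangle\langle i|_B$, and let $\mathcal{S}^d_{AB}(\omega)=F_{AB}\,\omega\,F_{AB}^\dagger$ be the unitary swap channel. Let $\hat A,\hat B$ be finite-dimensional systems of arbitrary, possibly different, dimensions, and let $\rho_{\hat A\hat B}$ be a state. Then $$e_{\mathrm{PPT}}(\mathcal{S}^d_{AB},\rho_{\hat A\hat B})=v_{\mathrm{PPT}}(\mathcal{S}^d_{AB},\rho_{\hat A\hat B})=1-\sup_{K,L,M,N}\operatorname{Tr}[\rho_{\hat A\hat B}K],$$ where the supremum is over all positive semi-definite operators $K,L,M,N$ on $\hat A\hat B$ such that $$K+L+M+N=I_{\hat A\hat B},$$ $$T_{\hat B}\Big(K+\frac{L}{d+1}+\frac{M}{d+1}+\frac{N}{(d+1)^2}\Big)\geq0,$$ $$\frac1{d-1}T_{\hat B}\Big(L+\frac{N}{d+1}\Big)\geq T_{\hat B}\Big(K+\frac{M}{d+1}\Big),$$ $$\frac1{d-1}T_{\hat B}\Big(M+\frac{N}{d+1}\Big)\geq T_{\hat B}\Big(K+\frac{L}{d+1}\Big),$$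 $$T_{\hat B}\Big(K+\frac{N}{(d-1)^2}\Big)\geq\frac1{d-1}T_{\hat B}(L+M).$$ The set of such $(K,L,M,N)$ is non-empty and $\operatorname{Tr}[\rho_{\hat A\hat B}K]$ is bounded above on it. -/

import Mathlib

open scoped ComplexOrder MatrixOrder Kronecker

namespace PPTSim

/-!
Finite-dimensional quantum systems are represented by finite index types (labelling an orthonormal
basis), operators by complex matrices, and a tensor product of systems by the product of index
types. The order `≤` on matrices is the Loewner order (scope `MatrixOrder`).
-/

section General

variable {C D R : Type*} [Fintype C] [DecidableEq C] [Fintype D] [DecidableEq D]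
  [Fintype R] [DecidableEq R]

/-- A quantum state: a positive semi-definite operator of trace one. -/
def IsState (ρ : Matrix C C ℂ) : Prop := 0 ≤ ρ ∧ ρ.trace = 1

/-- The trace norm `Tr √(X† X)`. -/
noncomputable def traceNorm (X : Matrix C C ℂ) : ℝ := (CFC.abs X).trace.re

/-- `(id_R ⊗ Φ)(X)`: the map `Φ` acts on each `C`-block of `X`. -/
def ampliate (Φ : Matrix C C ℂ →ₗ[ℂ] Matrix D D ℂ) (X : Matrix (R × C) (R × C) ℂ) :
    Matrix (R × D) (R × D) ℂ :=
  Matrix.of fun p q => Φ (Matrix.of fun c c' => X (p.1, c) (q.1, c')) p.2 q.2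

/-- Complete positivity: `id_R ⊗ Φ` preserves positivity for every finite-dimensional `R`. -/
def IsCP (Φ : Matrix C C ℂ →ₗ[ℂ] Matrix D D ℂ) : Prop :=
  ∀ (k : ℕ) (X : Matrix (Fin k × C) (Fin k × C) ℂ), 0 ≤ X → 0 ≤ ampliate Φ X

/-- A quantum channel: a completely positive and trace-preserving linear map. -/
def IsChannel (Φ : Matrix C C ℂ →ₗ[ℂ] Matrix D D ℂ) : Prop :=
  IsCP Φ ∧ ∀ X, (Φ X).trace = X.trace

/-- The diamond distance: the supremum, over all reference systems `R` and all states `ρ` of `RC`,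
of the trace norm of `N(ρ) - M(ρ)`. -/
noncomputable def diamondDist (N M : Matrix C C ℂ →ₗ[ℂ] Matrix D D ℂ) : ℝ :=
  sSup {t : ℝ | ∃ (r : ℕ) (ρ : Matrix (Fin r × C) (Fin r × C) ℂ), IsState ρ ∧
    t = traceNorm (ampliate N ρ - ampliate M ρ)}

/-- The unnormalized maximally entangled operator `|Γ⟩⟨Γ|` on `C ⊗ C`, `|Γ⟩ = ∑ i, |i⟩|i⟩`. -/
def maxEnt (C : Type*) [DecidableEq C] : Matrix (C × C) (C × C) ℂ :=
  Matrix.of fun p q => (if p.1 = p.2 then 1 else 0) * (if q.1 = q.2 then 1 else 0)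

/-- The Choi operator of a linear map (reference system first). -/
def choi (Φ : Matrix C C ℂ →ₗ[ℂ] Matrix D D ℂ) : Matrix (C × D) (C × D) ℂ :=
  ampliate Φ (maxEnt C)

/-- Partial trace over the second tensor factor. -/
def partialTrace₂ (X : Matrix (C × D) (C × D) ℂ) : Matrix C C ℂ :=
  Matrix.of fun c c' => ∑ d, X (c, d) (c', d)

/-- Partial transpose on the second tensor factor. -/
def partialTranspose₂ : Matrix (C × D) (C × D) ℂ →ₗ[ℂ] Matrix (C × D) (C × D) ℂ where
  toFun X := Matrix.of fun p q => X (p.1, q.2) (q.1, p.2)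
  map_add' _ _ := rfl
  map_smul' _ _ := rfl

end General

section Bipartite

variable {A B A' B' Ahat Bhat : Type*}
  [Fintype A] [DecidableEq A] [Fintype B] [DecidableEq B]
  [Fintype A'] [DecidableEq A'] [Fintype B'] [DecidableEq B']
  [Fintype Ahat] [DecidableEq Ahat] [Fintype Bhat] [DecidableEq Bhat]

/-- A bipartite map `P` from `A ⊗ B` to `A' ⊗ B'` completely preserves the positivity of the partial
transpose if `T_{B'} ∘ P ∘ T_B` is completely positive. -/
def IsCPPTP (P : Matrix (A × B) (A × B) ℂ →ₗ[ℂ] Matrix (A' × B') (A' × B') ℂ) : Prop :=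
  IsCP (partialTranspose₂ ∘ₗ P ∘ₗ partialTranspose₂)

/-- The map `ω ↦ P(ω ⊗ ρ)`, where Alice holds `A, Ahat` and Bob holds `B, Bhat`. -/
def simulate
    (P : Matrix ((A × Ahat) × (B × Bhat)) ((A × Ahat) × (B × Bhat)) ℂ →ₗ[ℂ]
      Matrix (A' × B') (A' × B') ℂ)
    (ρ : Matrix (Ahat × Bhat) (Ahat × Bhat) ℂ) :
    Matrix (A × B) (A × B) ℂ →ₗ[ℂ] Matrix (A' × B') (A' × B') ℂ where
  toFun ω := P ((ω ⊗ₖ ρ).reindex (Equiv.prodProdProdComm A B Ahat Bhat)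
    (Equiv.prodProdProdComm A B Ahat Bhat))
  map_add' X Y := by
    rw [Matrix.add_kronecker, ← map_add]; rfl
  map_smul' c X := by
    rw [Matrix.smul_kronecker, RingHom.id_apply, ← map_smul]; rfl

/-- The error, in normalized diamond distance, of simulating the bipartite map `N` with the
resource state `ρ` and C-PPT-P channels. -/
noncomputable def pptError
    (N : Matrix (A × B) (A × B) ℂ →ₗ[ℂ] Matrix (A' × B') (A' × B') ℂ)
    (ρ : Matrix (Ahat × Bhat) (Ahat × Bhat) ℂ) : ℝ :=
  (1 / 2) * sInf {t : ℝ |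
    ∃ P : Matrix ((A × Ahat) × (B × Bhat)) ((A × Ahat) × (B × Bhat)) ℂ →ₗ[ℂ]
        Matrix (A' × B') (A' × B') ℂ,
      IsChannel P ∧ IsCPPTP P ∧ t = diamondDist N (simulate P ρ)}

/-- The partial transpose `T_{BB'}` on operators on `(A ⊗ B) ⊗ (A' ⊗ B')`. -/
def bobTranspose (X : Matrix ((A × B) × (A' × B')) ((A × B) × (A' × B')) ℂ) :
    Matrix ((A × B) × (A' × B')) ((A × B) × (A' × B')) ℂ :=
  Matrix.of fun p q =>
    X ((p.1.1, q.1.2), (p.2.1, q.2.2)) ((q.1.1, p.1.2), (q.2.1, p.2.2))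

/-- Reordering of the tensor factors that moves `Ahat, Bhat` to the end. -/
def resourceLast (A B A' B' Ahat Bhat : Type*) :
    ((A × Ahat) × (B × Bhat)) × (A' × B') ≃ ((A × B) × (A' × B')) × (Ahat × Bhat) where
  toFun x := (((x.1.1.1, x.1.2.1), x.2), (x.1.1.2, x.1.2.2))
  invFun y := (((y.1.1.1, y.2.1), (y.1.1.2, y.2.2)), y.1.2)
  left_inv _ := rfl
  right_inv _ := rfl

/-- `Tr_{Ahat Bhat}[T_{Ahat Bhat}(ρ) P]`. -/
def contractResource (ρ : Matrix (Ahat × Bhat) (Ahat × Bhat) ℂ)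
    (P : Matrix (((A × Ahat) × (B × Bhat)) × (A' × B')) (((A × Ahat) × (B × Bhat)) × (A' × B')) ℂ) :
    Matrix ((A × B) × (A' × B')) ((A × B) × (A' × B')) ℂ :=
  partialTrace₂ (((1 : Matrix ((A × B) × (A' × B')) ((A × B) × (A' × B')) ℂ) ⊗ₖ ρ.transpose) *
    P.reindex (resourceLast A B A' B' Ahat Bhat) (resourceLast A B A' B' Ahat Bhat))

/-- Feasibility of `(μ, Z, P)` in the semi-definite program for the C-PPT-P simulation of `N` with
the resource state `ρ`. -/
structure IsSimFeasible
    (N : Matrix (A × B) (A × B) ℂ →ₗ[ℂ] Matrix (A' × B') (A' × B') ℂ)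
    (ρ : Matrix (Ahat × Bhat) (Ahat × Bhat) ℂ) (μ : ℝ)
    (Z : Matrix ((A × B) × (A' × B')) ((A × B) × (A' × B')) ℂ)
    (P : Matrix (((A × Ahat) × (B × Bhat)) × (A' × B')) (((A × Ahat) × (B × Bhat)) × (A' × B')) ℂ) :
    Prop where
  mu_nonneg : 0 ≤ μ
  Z_nonneg : 0 ≤ Z
  P_nonneg : 0 ≤ P
  le_mu : partialTrace₂ Z ≤ μ • (1 : Matrix (A × B) (A × B) ℂ)
  ppt : 0 ≤ bobTranspose P
  trace_eq : partialTrace₂ P = 1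
  le_Z : choi N - contractResource ρ P ≤ Z

/-- The optimal value of the semi-definite program for the C-PPT-P simulation error. -/
noncomputable def simValue
    (N : Matrix (A × B) (A × B) ℂ →ₗ[ℂ] Matrix (A' × B') (A' × B') ℂ)
    (ρ : Matrix (Ahat × Bhat) (Ahat × Bhat) ℂ) : ℝ :=
  sInf {μ : ℝ | ∃ Z P, IsSimFeasible N ρ μ Z P}

end Bipartite

section Swap

/-- The unitary swap operator `F = ∑ i j, |i⟩⟨j| ⊗ |j⟩⟨i|`. -/
def swapOp (d : ℕ) : Matrix (Fin d × Fin d) (Fin d × Fin d) ℂ :=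
  ∑ i : Fin d, ∑ j : Fin d, Matrix.single i j (1 : ℂ) ⊗ₖ Matrix.single j i (1 : ℂ)

/-- The unitary swap channel `X ↦ F X F†`. -/
def swapChannel (d : ℕ) : Matrix (Fin d × Fin d) (Fin d × Fin d) ℂ →ₗ[ℂ]
    Matrix (Fin d × Fin d) (Fin d × Fin d) ℂ where
  toFun X := swapOp d * X * (swapOp d).conjTranspose
  map_add' X Y := by rw [Matrix.mul_add, Matrix.add_mul]
  map_smul' c X := by simp

variable {Ahat Bhat : Type*} [Fintype Ahat] [DecidableEq Ahat] [Fintype Bhat] [DecidableEq Bhat]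

/-- Feasible `(K, L, M, N)` of the simplified semi-definite program: a four-outcome POVM subject to
four partial-transpose inequalities. -/
structure IsSwapFeasible (d : ℕ) (K L M N : Matrix (Ahat × Bhat) (Ahat × Bhat) ℂ) : Prop where
  K_nonneg : 0 ≤ K
  L_nonneg : 0 ≤ L
  M_nonneg : 0 ≤ M
  N_nonneg : 0 ≤ N
  ppt₁ : 0 ≤ partialTranspose₂
    (K + (1 / ((d : ℝ) + 1)) • L + (1 / ((d : ℝ) + 1)) • M + (1 / ((d : ℝ) + 1) ^ 2) • N)
  ppt₂ : partialTranspose₂ (K + (1 / ((d : ℝ) + 1)) • M) ≤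
    (1 / ((d : ℝ) - 1)) • partialTranspose₂ (L + (1 / ((d : ℝ) + 1)) • N)
  ppt₃ : partialTranspose₂ (K + (1 / ((d : ℝ) + 1)) • L) ≤
    (1 / ((d : ℝ) - 1)) • partialTranspose₂ (M + (1 / ((d : ℝ) + 1)) • N)
  ppt₄ : (1 / ((d : ℝ) - 1)) • partialTranspose₂ (L + M) ≤
    partialTranspose₂ (K + (1 / ((d : ℝ) - 1) ^ 2) • N)
  sum_eq : K + L + M + N = 1

/-- The objective values `Tr[ρ K]` of the simplified semi-definite program. -/
def swapObjective (d : ℕ) (ρ : Matrix (Ahat × Bhat) (Ahat × Bhat) ℂ) : Set ℝ :=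
  {t : ℝ | ∃ K L M N : Matrix (Ahat × Bhat) (Ahat × Bhat) ℂ,
    IsSwapFeasible d K L M N ∧ t = (ρ * K).trace.re}

end Swap

end PPTSim

set_option linter.unusedSectionVars false

namespace PPTSim

open Matrix

/-! ### Trace norm estimates for differences of positive operators. -/

section TraceNorm

variable {C D : Type*} [Fintype C] [DecidableEq C] [Fintype D] [DecidableEq D]

/-! The swap sends `A` to `B'` and `B` to `A'`, so its Choi operator is `d²` times the rank-one
projection `Φ ⊗ Φ`, with `Φ` maximally entangled, taken across the legs `A B'` and `B A'`. All that
matters about a simulating Choi operator `J` is therefore its overlap with the four products of `Φ`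
and `1 - Φ` on the two legs. Pairing `J` with them, up to the factor `d⁻²`, leaves operators `K, L,
M, N` on the resource; conversely, these four products with suitable weights assemble a `J` from `K,
L, M, N`.

The inequalities come from the partial transpose, which turns `Φ` into `F / d`, with `F` the flip.
Writing `S` and `A` for the symmetric and antisymmetric projections, `Φ + (1 - Φ)/(d+1)` becomes
`2S/(d+1)` and `(1 - Φ)/(d-1) - Φ` becomes `2A/(d-1)`. Positivity of the transposed `J` against `S ⊗
S`, `S ⊗ A`, `A ⊗ S`, `A ⊗ A` gives the four constraints (`exists_isSwapFeasible`). In the other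
direction the transposed `J` is exactly the sum of these four products, each tensored with the
transpose of the matching constraint operator (`exists_choi_of_isSwapFeasible`).

For the errors, put `k = Tr[ρ K]`. The channel built from `K, L, M, N` contains the fraction `k` of
the swap, so it lies within `2(1 - k)` in diamond distance (`diamondDist_le`), and `(1 - k)` times
the Choi operator of the swap serves as `Z`. Conversely, testing the output on the maximally
entangled input with `Φ ⊗ Φ` shows that no channel with overlap `k` does better (`le_diamondDist`);
the same test bounds `μ`. Feasible points thus match in both directions, and
`mul_sInf_eq_one_sub_sSup` passes to the optimal values without assuming that they are attained. -/

theorem nonneg_submatrix {X : Matrix C C ℂ} (hX : 0 ≤ X) (f : D → C) : 0 ≤ X.submatrix f f :=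
  nonneg_iff_posSemidef.2 ((nonneg_iff_posSemidef.1 hX).submatrix f)

theorem nonneg_transpose {X : Matrix C C ℂ} (hX : 0 ≤ X) : 0 ≤ Xᵀ :=
  nonneg_iff_posSemidef.2 (nonneg_iff_posSemidef.1 hX).transpose

theorem nonneg_kronecker {X : Matrix C C ℂ} {Y : Matrix D D ℂ} (hX : 0 ≤ X) (hY : 0 ≤ Y) :
    0 ≤ X ⊗ₖ Y :=
  nonneg_iff_posSemidef.2
    ((nonneg_iff_posSemidef.1 hX).kronecker (nonneg_iff_posSemidef.1 hY))

theorem nonneg_real_smul {X : Matrix C C ℂ} (hX : 0 ≤ X) {r : ℝ} (hr : 0 ≤ r) : 0 ≤ r • X := by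
  have h : 0 ≤ (r : ℂ) := by exact_mod_cast hr
  have := (nonneg_iff_posSemidef.1 hX).smul h
  have e : r • X = (r : ℂ) • X := by ext; simp
  rw [nonneg_iff_posSemidef, e]
  exact this

theorem trace_re_nonneg {X : Matrix C C ℂ} (hX : 0 ≤ X) : 0 ≤ X.trace.re :=
  (Complex.nonneg_iff.1 (nonneg_iff_posSemidef.1 hX).trace_nonneg).1

theorem trace_mul_nonneg {X Y : Matrix C C ℂ} (hX : 0 ≤ X) (hY : 0 ≤ Y) : 0 ≤ (X * Y).trace := by
  obtain ⟨B, rfl⟩ := CStarAlgebra.nonneg_iff_eq_star_mul_self.1 hY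
  rw [← Matrix.mul_assoc, Matrix.trace_mul_comm, ← Matrix.mul_assoc]
  exact ((nonneg_iff_posSemidef.1 hX).mul_mul_conjTranspose_same B).trace_nonneg

theorem traceNorm_nonneg (X : Matrix C C ℂ) : 0 ≤ traceNorm X :=
  trace_re_nonneg (CFC.abs_nonneg X)

theorem traceNorm_eq_sum_abs_eigenvalues {X : Matrix C C ℂ} (hX : X.IsHermitian) :
    traceNorm X = ∑ i, |hX.eigenvalues i| := by
  have h : CFC.abs X = hX.cfc (fun x => ‖x‖) := by
    rw [← hX.cfc_eq]
    exact CFC.abs_eq_cfc_norm X hX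
  rw [traceNorm, h, Matrix.IsHermitian.cfc, Unitary.conjStarAlgAut_apply, Matrix.trace_mul_cycle,
    Unitary.coe_star_mul_self, Matrix.one_mul, Matrix.trace_diagonal]
  simp

/-- In an eigenbasis of `X - Y` each eigenvalue is a difference of nonnegative diagonal entries of
`X` and `Y`, so its modulus is at most their sum. -/
theorem traceNorm_sub_le {X Y : Matrix C C ℂ} (hX : 0 ≤ X) (hY : 0 ≤ Y) :
    traceNorm (X - Y) ≤ X.trace.re + Y.trace.re := by
  have hX' := nonneg_iff_posSemidef.1 hX
  have hY' := nonneg_iff_posSemidef.1 hY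
  have h : (X - Y).IsHermitian := hX'.isHermitian.sub hY'.isHermitian
  rw [traceNorm_eq_sum_abs_eigenvalues h]
  set U : Matrix C C ℂ := (h.eigenvectorUnitary : Matrix C C ℂ) with hU
  have hUU : U * Uᴴ = 1 := Unitary.coe_mul_star_self h.eigenvectorUnitary
  have hd : Uᴴ * (X - Y) * U = diagonal (RCLike.ofReal ∘ h.eigenvalues) := by
    have := h.conjStarAlgAut_star_eigenvectorUnitary
    rw [Unitary.conjStarAlgAut_apply] at this
    rw [Unitary.coe_star, star_star] at this
    exact this
  have htr : ∀ Z : Matrix C C ℂ, (Uᴴ * Z * U).trace = Z.trace := fun Z => by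
    rw [Matrix.trace_mul_cycle, hUU, Matrix.one_mul]
  rw [← htr X, ← htr Y, Matrix.trace, Matrix.trace, Complex.re_sum, Complex.re_sum,
    ← Finset.sum_add_distrib]
  refine Finset.sum_le_sum fun i _ => ?_
  have h1 : 0 ≤ ((Uᴴ * X * U) i i).re :=
    (Complex.nonneg_iff.1 (hX'.conjTranspose_mul_mul_same U).diag_nonneg).1
  have h2 : 0 ≤ ((Uᴴ * Y * U) i i).re :=
    (Complex.nonneg_iff.1 (hY'.conjTranspose_mul_mul_same U).diag_nonneg).1
  have h3 : h.eigenvalues i = ((Uᴴ * X * U) i i).re - ((Uᴴ * Y * U) i i).re := by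
    have := congrFun (congrFun hd i) i
    rw [Matrix.mul_sub, Matrix.sub_mul, Matrix.sub_apply, Matrix.diagonal_apply_eq] at this
    have := congrArg Complex.re this
    simpa using this.symm
  rw [h3, abs_le]
  simp only [Matrix.diag_apply]
  constructor <;> linarith

/-- The left side is `Tr[W X] - Tr[(1 - W) X]`. Since `-|X| ≤ X ≤ |X|`, it is at most `Tr[W |X|] +
Tr[(1 - W) |X|] = Tr |X|`. -/
theorem two_mul_trace_sub_le_traceNorm {X W : Matrix C C ℂ} (hX : X.IsHermitian) (hW : 0 ≤ W)
    (hW1 : W ≤ 1) : 2 * (W * X).trace.re - X.trace.re ≤ traceNorm X := by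
  have hs : IsSelfAdjoint X := hX
  have h1 : 0 ≤ CFC.abs X - X := by
    rw [CFC.abs_sub_self X hs]
    exact nsmul_nonneg (CFC.negPart_nonneg X) 2
  have h2 : 0 ≤ CFC.abs X + X := by
    rw [CFC.abs_add_self X hs]
    exact nsmul_nonneg (CFC.posPart_nonneg X) 2
  have h3 := (Complex.nonneg_iff.1 (trace_mul_nonneg hW h1)).1
  have h4 := (Complex.nonneg_iff.1 (trace_mul_nonneg (sub_nonneg.2 hW1) h2)).1
  simp only [Matrix.mul_sub, Matrix.mul_add, Matrix.sub_mul, Matrix.one_mul, Matrix.trace_sub,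
    Matrix.trace_add, Complex.sub_re, Complex.add_re] at h3 h4
  rw [traceNorm]
  linarith

end TraceNorm

/-! ### Choi operators, complete positivity and the diamond distance. -/

section Choi

variable {C D R : Type*} [Fintype C] [DecidableEq C] [Fintype D] [DecidableEq D]
  [Fintype R] [DecidableEq R]

/-- The linear map with a given Choi operator. -/
def ofChoi (J : Matrix (C × D) (C × D) ℂ) : Matrix C C ℂ →ₗ[ℂ] Matrix D D ℂ where
  toFun X := Matrix.of fun p q => ∑ c, ∑ c', X c c' * J (c, p) (c', q)
  map_add' X Y := by
    ext p q
    simp [add_mul, Finset.sum_add_distrib]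
  map_smul' a X := by
    ext p q
    simp [Finset.mul_sum, mul_assoc]

theorem ofChoi_apply (J : Matrix (C × D) (C × D) ℂ) (X : Matrix C C ℂ) (p q : D) :
    ofChoi J X p q = ∑ c, ∑ c', X c c' * J (c, p) (c', q) := rfl

theorem maxEnt_nonneg : 0 ≤ maxEnt C := by
  rw [nonneg_iff_posSemidef]
  have h : maxEnt C = vecMulVec (fun p : C × C => if p.1 = p.2 then (1 : ℂ) else 0)
      (star fun p : C × C => if p.1 = p.2 then (1 : ℂ) else 0) := by
    ext p q
    simp [maxEnt, Matrix.vecMulVec_apply, apply_ite (starRingEnd ℂ)]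
  rw [h]
  exact posSemidef_vecMulVec_self_star _

theorem choi_apply (Φ : Matrix C C ℂ →ₗ[ℂ] Matrix D D ℂ) (p q : C × D) :
    choi Φ p q = Φ (Matrix.single p.1 q.1 1) p.2 q.2 := by
  have : (Matrix.of fun c c' => maxEnt C (p.1, c) (q.1, c')) = Matrix.single p.1 q.1 (1 : ℂ) := by
    ext c c'
    simp [maxEnt, Matrix.single_apply, ← ite_and, and_comm]
  rw [choi, ampliate, Matrix.of_apply, this]

theorem ofChoi_choi (Φ : Matrix C C ℂ →ₗ[ℂ] Matrix D D ℂ) : ofChoi (choi Φ) = Φ := by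
  refine LinearMap.ext fun X => Matrix.ext fun p q => ?_
  rw [ofChoi_apply]
  conv_rhs => rw [Matrix.matrix_eq_sum_single X]
  simp only [choi_apply, map_sum, Matrix.sum_apply]
  refine Finset.sum_congr rfl fun c _ => Finset.sum_congr rfl fun c' _ => ?_
  have h : Matrix.single c c' (X c c') = X c c' • Matrix.single c c' (1 : ℂ) := by simp
  rw [h, map_smul]
  rfl

theorem choi_ofChoi (J : Matrix (C × D) (C × D) ℂ) : choi (ofChoi J) = J := by
  ext ⟨c, p⟩ ⟨c', q⟩
  rw [choi_apply, ofChoi_apply]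
  simp [Matrix.single_apply, ite_and]

/-- Contracting the input of `X` with the reference of `J` is a congruence of `X ⊗ J` by `1 ⊗ |Γ⟩ ⊗
1`, written as a 0/1 matrix. Positivity of the ampliation follows at once. -/
theorem ampliate_ofChoi (J : Matrix (C × D) (C × D) ℂ) (X : Matrix (R × C) (R × C) ℂ) :
    ampliate (ofChoi J) X =
      (Matrix.of fun (x : (R × C) × (C × D)) (y : R × D) =>
        if x.1.1 = y.1 ∧ x.1.2 = x.2.1 ∧ x.2.2 = y.2 then (1 : ℂ) else 0)ᴴ * (X ⊗ₖ J) *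
      (Matrix.of fun (x : (R × C) × (C × D)) (y : R × D) =>
        if x.1.1 = y.1 ∧ x.1.2 = x.2.1 ∧ x.2.2 = y.2 then (1 : ℂ) else 0) := by
  ext ⟨r, p⟩ ⟨s, q⟩
  rw [ampliate, Matrix.of_apply, ofChoi_apply, Matrix.mul_apply]
  simp only [Matrix.mul_apply, Matrix.conjTranspose_apply, Matrix.of_apply,
    Fintype.sum_prod_type, kroneckerMap_apply]
  simp [ite_and, apply_ite (starRingEnd ℂ)]
  exact Finset.sum_comm

theorem ampliate_ofChoi_nonneg {J : Matrix (C × D) (C × D) ℂ} (hJ : 0 ≤ J)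
    {X : Matrix (R × C) (R × C) ℂ} (hX : 0 ≤ X) : 0 ≤ ampliate (ofChoi J) X := by
  rw [ampliate_ofChoi]
  exact nonneg_iff_posSemidef.2
    ((nonneg_iff_posSemidef.1 (nonneg_kronecker hX hJ)).conjTranspose_mul_mul_same _)

theorem ofChoi_nonneg {J : Matrix (C × D) (C × D) ℂ} (hJ : 0 ≤ J)
    {X : Matrix C C ℂ} (hX : 0 ≤ X) : 0 ≤ ofChoi J X :=
  nonneg_submatrix (ampliate_ofChoi_nonneg (R := Unit) hJ (nonneg_submatrix hX Prod.snd))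
    (fun p : D => ((), p))

/-- Complete positivity is tested on references `Fin k` only, so the reference `C` is relabelled by
`Fin (card C)` and back. -/
theorem choi_nonneg_of_isCP {Φ : Matrix C C ℂ →ₗ[ℂ] Matrix D D ℂ} (h : IsCP Φ) : 0 ≤ choi Φ :=
  nonneg_submatrix (h (Fintype.card C) _ (nonneg_submatrix (maxEnt_nonneg (C := C))
    (Prod.map (Fintype.equivFin C).symm id))) (Prod.map (Fintype.equivFin C) id) |>.trans_eq <| by
    ext p q
    simp [ampliate, choi]

theorem isCP_iff {Φ : Matrix C C ℂ →ₗ[ℂ] Matrix D D ℂ} : IsCP Φ ↔ 0 ≤ choi Φ :=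
  ⟨choi_nonneg_of_isCP, fun h k X hX => by
    rw [← ofChoi_choi Φ]; exact ampliate_ofChoi_nonneg h hX⟩

theorem ampliate_nonneg {Φ : Matrix C C ℂ →ₗ[ℂ] Matrix D D ℂ} (h : IsCP Φ)
    {X : Matrix (R × C) (R × C) ℂ} (hX : 0 ≤ X) : 0 ≤ ampliate Φ X := by
  rw [← ofChoi_choi Φ]; exact ampliate_ofChoi_nonneg (choi_nonneg_of_isCP h) hX

theorem trace_ofChoi (J : Matrix (C × D) (C × D) ℂ) (X : Matrix C C ℂ) :
    (ofChoi J X).trace = (Xᵀ * partialTrace₂ J).trace := by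
  simp only [Matrix.trace, Matrix.diag_apply, ofChoi_apply, Matrix.mul_apply, partialTrace₂,
    Matrix.of_apply, Matrix.transpose_apply, Finset.mul_sum]
  rw [Finset.sum_comm]
  conv_rhs => rw [Finset.sum_comm]
  refine Finset.sum_congr rfl fun c _ => ?_
  rw [Finset.sum_comm]

theorem tracePreserving_iff {Φ : Matrix C C ℂ →ₗ[ℂ] Matrix D D ℂ} :
    (∀ X, (Φ X).trace = X.trace) ↔ partialTrace₂ (choi Φ) = 1 := by
  constructor
  · intro h
    ext c c'
    have : partialTrace₂ (choi Φ) c c' = (Φ (Matrix.single c c' 1)).trace := by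
      simp [partialTrace₂, choi_apply, Matrix.trace]
    rw [this, h, Matrix.one_apply]
    by_cases hc : c = c'
    · subst hc; simp
    · simp [hc]
  · intro h X
    conv_lhs => rw [← ofChoi_choi Φ]
    rw [trace_ofChoi, h, Matrix.mul_one, Matrix.trace_transpose]

theorem isChannel_iff {Φ : Matrix C C ℂ →ₗ[ℂ] Matrix D D ℂ} :
    IsChannel Φ ↔ 0 ≤ choi Φ ∧ partialTrace₂ (choi Φ) = 1 := by
  rw [IsChannel, isCP_iff, tracePreserving_iff]

theorem trace_ampliate {Φ : Matrix C C ℂ →ₗ[ℂ] Matrix D D ℂ}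
    (h : ∀ X, (Φ X).trace = X.trace) (X : Matrix (R × C) (R × C) ℂ) :
    (ampliate Φ X).trace = X.trace := by
  have : ∀ r, ∑ p, ampliate Φ X (r, p) (r, p) = ∑ c, X (r, c) (r, c) := fun r =>
    h (Matrix.of fun c c' => X (r, c) (r, c'))
  simp [Matrix.trace, Fintype.sum_prod_type, this]

theorem ampliate_sub_smul (N M : Matrix C C ℂ →ₗ[ℂ] Matrix D D ℂ) (k : ℝ)
    (X : Matrix (R × C) (R × C) ℂ) :
    ampliate (M - (k : ℂ) • N) X = ampliate M X - k • ampliate N X := by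
  ext p q
  simp [ampliate]

theorem choi_sub_smul (N M : Matrix C C ℂ →ₗ[ℂ] Matrix D D ℂ) (k : ℝ) :
    choi (M - (k : ℂ) • N) = choi M - k • choi N :=
  ampliate_sub_smul N M k _

/-- A real `sSup` over an unbounded set takes the value 0, so boundedness is needed before any state
can give a lower bound. -/
theorem bddAbove_diamond {N M : Matrix C C ℂ →ₗ[ℂ] Matrix D D ℂ} (hN : IsChannel N)
    (hM : IsChannel M) : BddAbove {t : ℝ | ∃ (r : ℕ) (ρ : Matrix (Fin r × C) (Fin r × C) ℂ),
      IsState ρ ∧ t = traceNorm (ampliate N ρ - ampliate M ρ)} := by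
  refine ⟨2, ?_⟩
  rintro t ⟨r, ρ, hρ, rfl⟩
  refine (traceNorm_sub_le (ampliate_nonneg hN.1 hρ.1) (ampliate_nonneg hM.1 hρ.1)).trans ?_
  rw [trace_ampliate hN.2, trace_ampliate hM.2, hρ.2]
  norm_num

/-- If `M` contains the fraction `k` of the channel `N`, it is within `2 (1 - k)` of `N`. -/
theorem diamondDist_le {N M : Matrix C C ℂ →ₗ[ℂ] Matrix D D ℂ} (hN : IsChannel N)
    (hM : IsChannel M) {k : ℝ} (hk : k ≤ 1) (h : k • choi N ≤ choi M) :
    diamondDist N M ≤ 2 * (1 - k) := by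
  -- Nonnegativity of the bound covers the case of an empty set of states.
  refine Real.sSup_le ?_ (by linarith)
  rintro t ⟨r, ρ, hρ, rfl⟩
  have hE : IsCP (M - (k : ℂ) • N) := isCP_iff.2 (by rw [choi_sub_smul]; exact sub_nonneg.2 h)
  have h1 := nonneg_real_smul (ampliate_nonneg hN.1 hρ.1) (sub_nonneg.2 hk)
  have h2 := ampliate_nonneg hE hρ.1
  have h3 := traceNorm_sub_le h1 h2
  rw [ampliate_sub_smul] at h3
  -- The difference of the outputs is split into two positive parts, each of trace `1 - k`.
  have h4 : (1 - k) • ampliate N ρ - (ampliate M ρ - k • ampliate N ρ) =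
      ampliate N ρ - ampliate M ρ := by module
  rw [h4] at h3
  refine h3.trans_eq ?_
  simp only [Matrix.trace_sub, Matrix.trace_smul, trace_ampliate hN.2, trace_ampliate hM.2, hρ.2]
  simp
  ring

/-- Lower bound on the diamond distance from the maximally entangled input and a test `W`. -/
theorem le_diamondDist [Nonempty C] {N M : Matrix C C ℂ →ₗ[ℂ] Matrix D D ℂ} (hN : IsChannel N)
    (hM : IsChannel M) {W : Matrix (C × D) (C × D) ℂ} (hW : 0 ≤ W) (hW1 : W ≤ 1) :
    2 * ((Fintype.card C : ℝ)⁻¹ * (W * (choi N - choi M)).trace.re) ≤ diamondDist N M := by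
  set e := Fintype.equivFin C
  set c : ℝ := (Fintype.card C : ℝ)⁻¹ with hc
  -- The normalized maximally entangled state, with its reference relabelled because the diamond
  -- distance ranges over references `Fin r`.
  set ρ : Matrix (Fin (Fintype.card C) × C) (Fin (Fintype.card C) × C) ℂ :=
    c • (maxEnt C).submatrix (Prod.map e.symm id) (Prod.map e.symm id) with hρ
  have hst : IsState ρ := by
    refine ⟨nonneg_real_smul (nonneg_submatrix maxEnt_nonneg _) (by positivity), ?_⟩
    have : ((maxEnt C).submatrix (Prod.map e.symm id) (Prod.map e.symm id)).trace =
        (Fintype.card C : ℂ) := by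
      simp only [Matrix.trace, Matrix.diag_apply, Matrix.submatrix_apply, Fintype.sum_prod_type,
        Prod.map_apply, id]
      rw [e.symm.sum_comp (fun x => ∑ y, maxEnt C (x, y) (x, y))]
      simp [maxEnt]
    rw [hρ, Matrix.trace_smul, this, hc]
    simp
  have ham : ∀ Φ : Matrix C C ℂ →ₗ[ℂ] Matrix D D ℂ, ampliate Φ ρ =
      c • (choi Φ).submatrix (Prod.map e.symm id) (Prod.map e.symm id) := fun Φ => by
    ext p q
    have : (Matrix.of fun c c' => ρ (p.1, c) (q.1, c')) = (c : ℂ) •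
      (Matrix.of fun c c' => maxEnt C (e.symm p.1, c) (e.symm q.1, c')) := by
      ext; simp [hρ]
    rw [ampliate, Matrix.of_apply, this, map_smul]
    simp [choi, ampliate]
  refine le_csSup_of_le (bddAbove_diamond hN hM) ⟨_, ρ, hst, rfl⟩ ?_
  have hH : (ampliate N ρ - ampliate M ρ).IsHermitian :=
    (nonneg_iff_posSemidef.1 (ampliate_nonneg hN.1 hst.1)).isHermitian.sub
      (nonneg_iff_posSemidef.1 (ampliate_nonneg hM.1 hst.1)).isHermitian
  have key := two_mul_trace_sub_le_traceNorm (W := W.submatrix (Prod.map e.symm id)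
    (Prod.map e.symm id)) hH (nonneg_submatrix hW _) (by
      have := nonneg_submatrix (sub_nonneg.2 hW1)
        (Prod.map e.symm (id : D → D))
      rw [Matrix.submatrix_sub] at this
      simp only [Pi.sub_apply] at this
      rw [Matrix.submatrix_one _ (e.symm.injective.prodMap Function.injective_id)] at this
      exact sub_nonneg.1 this)
  -- Both maps preserve the trace, so the term `-Tr X` of the test bound vanishes.
  refine le_trans (le_of_eq ?_) key
  rw [Matrix.trace_sub, trace_ampliate hN.2, trace_ampliate hM.2, sub_self, Complex.zero_re,
    sub_zero, ham, ham, ← smul_sub, Matrix.mul_smul, Matrix.trace_smul, Complex.real_smul,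
    Complex.re_ofReal_mul]
  congr 3
  have h5 : (choi N).submatrix (Prod.map e.symm id) (Prod.map e.symm id) -
      (choi M).submatrix (Prod.map e.symm id) (Prod.map e.symm id) =
      (choi N - choi M).submatrix (e.symm.prodCongr (Equiv.refl D))
        (e.symm.prodCongr (Equiv.refl D)) := rfl
  have h6 : W.submatrix (Prod.map e.symm id) (Prod.map e.symm id) =
      W.submatrix (e.symm.prodCongr (Equiv.refl D)) (e.symm.prodCongr (Equiv.refl D)) := rfl
  rw [h5, h6, Matrix.submatrix_mul_equiv]
  exact (Equiv.sum_comp (e.symm.prodCongr (Equiv.refl D))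
    fun x => (W * (choi N - choi M)) x x).symm

end Choi

/-! ### Bipartite maps, contraction with the resource, and regrouping into legs. -/

section Bipartite

variable {A B A' B' Ahat Bhat : Type*}
  [Fintype A] [DecidableEq A] [Fintype B] [DecidableEq B]
  [Fintype A'] [DecidableEq A'] [Fintype B'] [DecidableEq B']
  [Fintype Ahat] [DecidableEq Ahat] [Fintype Bhat] [DecidableEq Bhat]

theorem choi_conj_partialTranspose (J : Matrix ((A × B) × (A' × B')) ((A × B) × (A' × B')) ℂ) :
    choi (partialTranspose₂ ∘ₗ ofChoi J ∘ₗ partialTranspose₂) = bobTranspose J := by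
  ext ⟨⟨a, b⟩, ⟨a', b'⟩⟩ ⟨⟨e, f⟩, ⟨e', f'⟩⟩
  have h : partialTranspose₂ (Matrix.single (a, b) (e, f) (1 : ℂ)) =
      Matrix.single (a, f) (e, b) 1 := by
    ext ⟨x, y⟩ ⟨z, w⟩
    change Matrix.single (a, b) (e, f) (1 : ℂ) (x, w) (z, y) = _
    simp only [Matrix.single_apply, Prod.mk.injEq]
    refine if_congr ?_ rfl rfl
    tauto
  rw [choi_apply, LinearMap.comp_apply, LinearMap.comp_apply, h]
  change ofChoi J _ (a', f') (e', b') = _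
  rw [← choi_apply (ofChoi J) ((a, f), (a', f')) ((e, b), (e', b')), choi_ofChoi]
  rfl

theorem isCPPTP_iff {P : Matrix (A × B) (A × B) ℂ →ₗ[ℂ] Matrix (A' × B') (A' × B') ℂ} :
    IsCPPTP P ↔ 0 ≤ bobTranspose (choi P) := by
  rw [IsCPPTP, isCP_iff, ← choi_conj_partialTranspose, ofChoi_choi]

theorem contractResource_apply (ρ : Matrix (Ahat × Bhat) (Ahat × Bhat) ℂ)
    (J : Matrix (((A × Ahat) × (B × Bhat)) × (A' × B')) (((A × Ahat) × (B × Bhat)) × (A' × B')) ℂ)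
    (x y : (A × B) × (A' × B')) :
    contractResource ρ J x y = ∑ h, ∑ k, ρ k h *
      J ((resourceLast A B A' B' Ahat Bhat).symm (x, k))
        ((resourceLast A B A' B' Ahat Bhat).symm (y, h)) := by
  rw [contractResource, partialTrace₂, Matrix.of_apply]
  refine Finset.sum_congr rfl fun h _ => ?_
  rw [Matrix.mul_apply, Fintype.sum_prod_type, Finset.sum_eq_single x]
  · simp
  · intro z _ hz
    simp [hz.symm]
  · simp

/-- Read with the resource as input, `J` is a positive Choi operator, and the contraction is its map
applied to `ρ`. -/
theorem contractResource_nonneg {ρ : Matrix (Ahat × Bhat) (Ahat × Bhat) ℂ} (hρ : 0 ≤ ρ)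
    {J : Matrix (((A × Ahat) × (B × Bhat)) × (A' × B')) (((A × Ahat) × (B × Bhat)) × (A' × B')) ℂ}
    (hJ : 0 ≤ J) : 0 ≤ contractResource ρ J := by
  have h : contractResource ρ J = ofChoi (J.submatrix
      (fun z => (resourceLast A B A' B' Ahat Bhat).symm (z.2, z.1))
      (fun z => (resourceLast A B A' B' Ahat Bhat).symm (z.2, z.1))) ρ := by
    ext x y
    rw [contractResource_apply, ofChoi_apply, Finset.sum_comm]
    rfl
  rw [h]
  exact ofChoi_nonneg (nonneg_submatrix hJ _) hρ

theorem choi_simulate_ofChoi (ρ : Matrix (Ahat × Bhat) (Ahat × Bhat) ℂ)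
    (J : Matrix (((A × Ahat) × (B × Bhat)) × (A' × B'))
      (((A × Ahat) × (B × Bhat)) × (A' × B')) ℂ) :
    choi (simulate (ofChoi J) ρ) = contractResource ρ J := by
  ext ⟨x, p⟩ ⟨y, q⟩
  rw [choi_apply, contractResource_apply]
  change ofChoi J _ p q = _
  rw [ofChoi_apply, ← (Equiv.prodProdProdComm A B Ahat Bhat).sum_comp, Fintype.sum_prod_type,
    Finset.sum_eq_single x]
  · rw [Finset.sum_comm, ← (Equiv.prodProdProdComm A B Ahat Bhat).sum_comp, Fintype.sum_prod_type,
      Finset.sum_eq_single y]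
    · refine Finset.sum_congr rfl fun h _ => Finset.sum_congr rfl fun k _ => ?_
      simp [resourceLast]
    · intro z _ hz
      simp [hz.symm]
    · simp
  · intro z _ hz
    refine Finset.sum_eq_zero fun h _ => ?_
    rw [← (Equiv.prodProdProdComm A B Ahat Bhat).sum_comp]
    simp [hz.symm]
  · simp

theorem isChannel_simulate
    {P : Matrix ((A × Ahat) × (B × Bhat)) ((A × Ahat) × (B × Bhat)) ℂ →ₗ[ℂ]
      Matrix (A' × B') (A' × B') ℂ} (hP : IsChannel P)
    {ρ : Matrix (Ahat × Bhat) (Ahat × Bhat) ℂ} (hρ : IsState ρ) : IsChannel (simulate P ρ) := by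
  constructor
  · rw [isCP_iff, ← ofChoi_choi P, choi_simulate_ofChoi]
    exact contractResource_nonneg hρ.1 (isChannel_iff.1 hP).1
  · intro X
    change (P _).trace = _
    rw [hP.2]
    have : ((X ⊗ₖ ρ).reindex (Equiv.prodProdProdComm A B Ahat Bhat)
        (Equiv.prodProdProdComm A B Ahat Bhat)).trace = (X ⊗ₖ ρ).trace :=
      Equiv.sum_comp (Equiv.prodProdProdComm A B Ahat Bhat).symm fun x => (X ⊗ₖ ρ) x x
    rw [this, Matrix.trace_kronecker, hρ.2, mul_one]

/-- The regrouping `(A Ahat)(B Bhat)(A' B') → (A B')(B A')(Ahat Bhat)`. -/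
def toLegs (x : ((A × Ahat) × (B × Bhat)) × (A' × B')) :
    ((A × B') × (B × A')) × (Ahat × Bhat) :=
  (((x.1.1.1, x.2.2), (x.1.2.1, x.2.1)), (x.1.1.2, x.1.2.2))

/-- The inverse of `toLegs`. -/
def ofLegs (y : ((A × B') × (B × A')) × (Ahat × Bhat)) :
    ((A × Ahat) × (B × Bhat)) × (A' × B') :=
  (((y.1.1.1, y.2.1), (y.1.2.1, y.2.2)), (y.1.2.2, y.1.1.2))

/-- The regrouping `(A B)(A' B') → (A B')(B A')`. -/
def crossLegs (A B A' B' : Type*) : (A × B) × (A' × B') ≃ (A × B') × (B × A') where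
  toFun x := ((x.1.1, x.2.2), (x.1.2, x.2.1))
  invFun y := ((y.1.1, y.2.1), (y.2.2, y.1.2))
  left_inv _ := rfl
  right_inv _ := rfl

/-- The partial transpose `T_{B' B Bhat}` on operators on `(A B')(B A')(Ahat Bhat)`. -/
def transposeLegs (Q : Matrix (((A × B') × (B × A')) × (Ahat × Bhat))
    (((A × B') × (B × A')) × (Ahat × Bhat)) ℂ) :
    Matrix (((A × B') × (B × A')) × (Ahat × Bhat)) (((A × B') × (B × A')) × (Ahat × Bhat)) ℂ :=
  Matrix.of fun p q =>
    Q (((p.1.1.1, q.1.1.2), (q.1.2.1, p.1.2.2)), (p.2.1, q.2.2))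
      (((q.1.1.1, p.1.1.2), (p.1.2.1, q.1.2.2)), (q.2.1, p.2.2))

/-- The partial transpose `T_{B' B}` on operators on `(A B')(B A')`. -/
def transposePair (W : Matrix ((A × B') × (B × A')) ((A × B') × (B × A')) ℂ) :
    Matrix ((A × B') × (B × A')) ((A × B') × (B × A')) ℂ :=
  Matrix.of fun x y =>
    W ((x.1.1, y.1.2), (y.2.1, x.2.2)) ((y.1.1, x.1.2), (x.2.1, y.2.2))

/-- The involution of pairs of indices underlying `transposePair`. -/
def transposePairEquiv (A B A' B' : Type*) :
    (((A × B') × (B × A')) × ((A × B') × (B × A'))) ≃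
      (((A × B') × (B × A')) × ((A × B') × (B × A'))) where
  toFun z := (((z.1.1.1, z.2.1.2), (z.2.2.1, z.1.2.2)), ((z.2.1.1, z.1.1.2), (z.1.2.1, z.2.2.2)))
  invFun z := (((z.1.1.1, z.2.1.2), (z.2.2.1, z.1.2.2)), ((z.2.1.1, z.1.1.2), (z.1.2.1, z.2.2.2)))
  left_inv _ := rfl
  right_inv _ := rfl

/-- Applying the transpose on `B'` and `B` to both `Q` and `W` only permutes the summation indices
of the contraction, so only the transpose on `Bhat` is visible in the result. -/
theorem partialTranspose_ofChoi (Q : Matrix (((A × B') × (B × A')) × (Ahat × Bhat))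
    (((A × B') × (B × A')) × (Ahat × Bhat)) ℂ)
    (W : Matrix ((A × B') × (B × A')) ((A × B') × (B × A')) ℂ) :
    partialTranspose₂ (ofChoi Q W) = ofChoi (transposeLegs Q) (transposePair W) := by
  ext p q
  change ofChoi Q W (p.1, q.2) (q.1, p.2) = _
  rw [ofChoi_apply, ofChoi_apply, ← Fintype.sum_prod_type', ← Fintype.sum_prod_type',
    ← (transposePairEquiv A B A' B').sum_comp]
  rfl

theorem sum_prod_prod_type {α β γ δ : Type*} [Fintype α] [Fintype β] [Fintype γ] [Fintype δ]
    (f : (α × β) × (γ × δ) → ℂ) :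
    ∑ z, f z = ∑ a, ∑ b, ∑ c, ∑ d, f ((a, b), (c, d)) := by
  rw [Fintype.sum_prod_type, Fintype.sum_prod_type]
  exact Finset.sum_congr rfl fun a _ => Finset.sum_congr rfl fun b _ => Fintype.sum_prod_type _

/-- Both sides are the same sum in two orders. This turns the objective `Tr[ρ K]` into an overlap
with the Choi operator of the simulated channel. -/
theorem trace_mul_transpose_ofChoi (ρ : Matrix (Ahat × Bhat) (Ahat × Bhat) ℂ)
    (J : Matrix (((A × Ahat) × (B × Bhat)) × (A' × B')) (((A × Ahat) × (B × Bhat)) × (A' × B')) ℂ)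
    (W : Matrix ((A × B') × (B × A')) ((A × B') × (B × A')) ℂ) :
    (ρ * (ofChoi (J.submatrix ofLegs ofLegs) W)ᵀ).trace =
      (Wᵀ.submatrix (crossLegs A B A' B') (crossLegs A B A' B') *
        contractResource ρ J).trace := by
  simp only [Matrix.trace, Matrix.diag_apply, Matrix.mul_apply, contractResource_apply,
    Matrix.transpose_apply, Matrix.submatrix_apply, ofChoi_apply, Finset.mul_sum]
  let e : ((Ahat × Bhat) × (Ahat × Bhat)) × (((A × B') × (B × A')) × ((A × B') × (B × A'))) ≃
      (((A × B) × (A' × B')) × ((A × B) × (A' × B'))) × ((Ahat × Bhat) × (Ahat × Bhat)) :=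
    { toFun := fun z => (((crossLegs A B A' B').symm z.2.2, (crossLegs A B A' B').symm z.2.1),
        (z.1.2, z.1.1))
      invFun := fun z => ((z.2.2, z.2.1), (crossLegs A B A' B' z.1.2, crossLegs A B A' B' z.1.1))
      left_inv := fun _ => rfl
      right_inv := fun _ => rfl }
  let F : ((Ahat × Bhat) × (Ahat × Bhat)) × (((A × B') × (B × A')) × ((A × B') × (B × A'))) → ℂ :=
    fun z => ρ z.1.1 z.1.2 *
      (W z.2.1 z.2.2 * J (ofLegs (z.2.1, z.1.1)) (ofLegs (z.2.2, z.1.2)))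
  let G : (((A × B) × (A' × B')) × ((A × B) × (A' × B'))) × ((Ahat × Bhat) × (Ahat × Bhat)) → ℂ :=
    fun z => W (crossLegs A B A' B' z.1.2) (crossLegs A B A' B' z.1.1) *
      (ρ z.2.2 z.2.1 * J ((resourceLast A B A' B' Ahat Bhat).symm (z.1.2, z.2.2))
        ((resourceLast A B A' B' Ahat Bhat).symm (z.1.1, z.2.1)))
  have hFG : ∀ z, F z = G (e z) := fun z => mul_left_comm _ _ _
  have h : ∑ z, F z = ∑ z, G z := by
    rw [← e.sum_comp]
    exact Finset.sum_congr rfl fun z _ => hFG z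
  rw [sum_prod_prod_type, sum_prod_prod_type] at h
  exact h

theorem contractResource_add (ρ : Matrix (Ahat × Bhat) (Ahat × Bhat) ℂ)
    (J J' : Matrix (((A × Ahat) × (B × Bhat)) × (A' × B'))
      (((A × Ahat) × (B × Bhat)) × (A' × B')) ℂ) :
    contractResource ρ (J + J') = contractResource ρ J + contractResource ρ J' := by
  ext x y
  simp [contractResource_apply, mul_add, Finset.sum_add_distrib]

theorem contractResource_smul (ρ : Matrix (Ahat × Bhat) (Ahat × Bhat) ℂ) (r : ℝ)
    (J : Matrix (((A × Ahat) × (B × Bhat)) × (A' × B'))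
      (((A × Ahat) × (B × Bhat)) × (A' × B')) ℂ) :
    contractResource ρ (r • J) = r • contractResource ρ J := by
  ext x y
  simp [contractResource_apply, Finset.mul_sum, mul_left_comm]

theorem contractResource_kronecker (ρ Y : Matrix (Ahat × Bhat) (Ahat × Bhat) ℂ)
    (W : Matrix ((A × B') × (B × A')) ((A × B') × (B × A')) ℂ) :
    contractResource ρ ((W ⊗ₖ Yᵀ).submatrix toLegs toLegs) =
      (ρ * Y).trace • W.submatrix (crossLegs A B A' B') (crossLegs A B A' B') := by
  ext x y
  rw [contractResource_apply]
  simp only [Matrix.trace, Matrix.diag_apply, Matrix.mul_apply, Matrix.smul_apply, smul_eq_mul,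
    Finset.sum_mul]
  rw [Finset.sum_comm]
  refine Finset.sum_congr rfl fun h _ => Finset.sum_congr rfl fun k _ => ?_
  simp [toLegs, crossLegs, resourceLast]
  ring

theorem partialTrace_kronecker_legs
    (W₁ : Matrix (A × B') (A × B') ℂ) (W₂ : Matrix (B × A') (B × A') ℂ)
    (Y : Matrix (Ahat × Bhat) (Ahat × Bhat) ℂ) :
    partialTrace₂ (((W₁ ⊗ₖ W₂) ⊗ₖ Y).submatrix
      (toLegs (A := A) (B := B) (A' := A') (B' := B')) toLegs) =
      Matrix.of fun c c' => partialTrace₂ W₁ c.1.1 c'.1.1 * partialTrace₂ W₂ c.2.1 c'.2.1 *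
        Y (c.1.2, c.2.2) (c'.1.2, c'.2.2) := by
  ext c c'
  change ∑ z : A' × B', W₁ (c.1.1, z.2) (c'.1.1, z.2) * W₂ (c.2.1, z.1) (c'.2.1, z.1) *
      Y (c.1.2, c.2.2) (c'.1.2, c'.2.2) =
    (∑ i, W₁ (c.1.1, i) (c'.1.1, i)) * (∑ j, W₂ (c.2.1, j) (c'.2.1, j)) *
      Y (c.1.2, c.2.2) (c'.1.2, c'.2.2)
  rw [Fintype.sum_prod_type, Finset.sum_comm, Finset.sum_mul_sum, Finset.sum_mul]
  refine Finset.sum_congr rfl fun i _ => ?_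
  rw [Finset.sum_mul]

theorem ofChoi_legs_one (J : Matrix (((A × Ahat) × (B × Bhat)) × (A' × B'))
    (((A × Ahat) × (B × Bhat)) × (A' × B')) ℂ) (hJ : partialTrace₂ J = 1) :
    ofChoi (J.submatrix ofLegs ofLegs) (1 : Matrix ((A × B') × (B × A')) ((A × B') × (B × A')) ℂ) =
      ((Fintype.card A : ℂ) * Fintype.card B) • (1 : Matrix (Ahat × Bhat) (Ahat × Bhat) ℂ) := by
  ext h k
  have h1 : ofChoi (J.submatrix ofLegs ofLegs)
      (1 : Matrix ((A × B') × (B × A')) ((A × B') × (B × A')) ℂ) h k =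
      ∑ x : (A × B') × (B × A'), J (ofLegs (x, h)) (ofLegs (x, k)) := by
    simp [ofChoi_apply, Matrix.one_apply]
  have h2 : ∀ a b, ∑ z, J (((a, h.1), (b, h.2)), z) (((a, k.1), (b, k.2)), z) =
      (1 : Matrix (Ahat × Bhat) (Ahat × Bhat) ℂ) h k := fun a b => by
    have := congrFun (congrFun hJ ((a, h.1), (b, h.2))) ((a, k.1), (b, k.2))
    rw [partialTrace₂, Matrix.of_apply] at this
    rw [this]
    simp [Matrix.one_apply, Prod.ext_iff]
  rw [h1, ← (crossLegs A B A' B').sum_comp, Fintype.sum_prod_type]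
  change ∑ x : A × B, ∑ z, J (((x.1, h.1), (x.2, h.2)), z) (((x.1, k.1), (x.2, k.2)), z) = _
  simp [h2]

end Bipartite

/-! ### The maximally entangled, symmetric and antisymmetric projections. -/

section Projections

theorem sub_kronecker {C D : Type*} (X Y : Matrix C C ℂ) (Z : Matrix D D ℂ) :
    (X - Y) ⊗ₖ Z = X ⊗ₖ Z - Y ⊗ₖ Z := by
  ext; simp [sub_mul]

theorem kronecker_sub {C D : Type*} (X : Matrix C C ℂ) (Y Z : Matrix D D ℂ) :
    X ⊗ₖ (Y - Z) = X ⊗ₖ Y - X ⊗ₖ Z := by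
  ext; simp [mul_sub]

/-- The normalized maximally entangled projection. -/
noncomputable def entProj (d : ℕ) : Matrix (Fin d × Fin d) (Fin d × Fin d) ℂ :=
  (1 / (d : ℝ)) • maxEnt (Fin d)

/-- The flip operator on two copies of `ℂ^d`. -/
def flipOp (d : ℕ) : Matrix (Fin d × Fin d) (Fin d × Fin d) ℂ :=
  partialTranspose₂ (maxEnt (Fin d))

/-- The projection onto the symmetric subspace. -/
noncomputable def symProj (d : ℕ) : Matrix (Fin d × Fin d) (Fin d × Fin d) ℂ :=
  (1 / 2 : ℝ) • (1 + flipOp d)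

/-- The projection onto the antisymmetric subspace. -/
noncomputable def altProj (d : ℕ) : Matrix (Fin d × Fin d) (Fin d × Fin d) ℂ :=
  (1 / 2 : ℝ) • (1 - flipOp d)

theorem flipOp_apply {d : ℕ} (p q : Fin d × Fin d) :
    flipOp d p q = if q = p.swap then 1 else 0 := by
  change (if p.1 = q.2 then (1 : ℂ) else 0) * (if q.1 = p.2 then 1 else 0) = _
  simp only [mul_ite, mul_one, mul_zero, ← ite_and]
  refine if_congr ?_ rfl rfl
  simp only [Prod.ext_iff, Prod.fst_swap, Prod.snd_swap]
  tauto

theorem flipOp_mul_self (d : ℕ) : flipOp d * flipOp d = 1 := by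
  ext p q
  simp only [Matrix.mul_apply, flipOp_apply, Matrix.one_apply, ite_mul, one_mul, zero_mul,
    Finset.sum_ite_eq', Finset.mem_univ, if_true, Prod.swap_swap]
  exact if_congr eq_comm rfl rfl

theorem flipOp_conjTranspose (d : ℕ) : (flipOp d)ᴴ = flipOp d := by
  ext p q
  have : p = q.swap ↔ q = p.swap := by
    constructor <;> rintro rfl <;> simp
  simp [flipOp_apply, this, apply_ite (starRingEnd ℂ)]

theorem swapOp_eq_flipOp (d : ℕ) : swapOp d = flipOp d := by
  ext p q
  simp only [swapOp, Matrix.sum_apply, kroneckerMap_apply, Matrix.single_apply, flipOp_apply,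
    Prod.ext_iff, Prod.fst_swap, Prod.snd_swap]
  rw [Finset.sum_eq_single p.1, Finset.sum_eq_single q.1]
  · simp only [and_true, mul_ite, mul_one, mul_zero, ← ite_and]
    refine if_congr ?_ rfl rfl
    tauto
  · intro b _ hb
    simp [hb]
  · simp
  · intro b _ hb
    simp [hb]
  · simp

theorem nonneg_of_isHermitian_of_mul_self {C : Type*} [Fintype C] [DecidableEq C]
    {X : Matrix C C ℂ} (hX : Xᴴ = X) (h : X * X = X) : 0 ≤ X := by
  rw [nonneg_iff_posSemidef, ← h]
  nth_rw 1 [← hX]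
  exact posSemidef_conjTranspose_mul_self X

theorem symProj_nonneg (d : ℕ) : 0 ≤ symProj d := by
  apply nonneg_of_isHermitian_of_mul_self
  · simp [symProj, Matrix.conjTranspose_smul, flipOp_conjTranspose]
  · simp only [symProj, Matrix.smul_mul, Matrix.mul_smul, mul_add, add_mul, flipOp_mul_self,
      Matrix.one_mul, Matrix.mul_one]
    module

theorem altProj_nonneg (d : ℕ) : 0 ≤ altProj d := by
  apply nonneg_of_isHermitian_of_mul_self
  · simp [altProj, Matrix.conjTranspose_smul, flipOp_conjTranspose]
  · simp only [altProj, Matrix.smul_mul, Matrix.mul_smul, mul_sub, sub_mul, flipOp_mul_self,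
      Matrix.one_mul, Matrix.mul_one]
    module

theorem entProj_nonneg (d : ℕ) : 0 ≤ entProj d :=
  nonneg_real_smul maxEnt_nonneg (by positivity)

theorem entProj_transpose (d : ℕ) : (entProj d)ᵀ = entProj d := by
  ext p q
  simp only [entProj, maxEnt, Matrix.transpose_apply, Matrix.smul_apply, Matrix.of_apply]
  rw [mul_comm]

theorem entProj_conjTranspose (d : ℕ) : (entProj d)ᴴ = entProj d :=
  (nonneg_iff_posSemidef.1 (entProj_nonneg d)).isHermitian

theorem entProj_mul_self {d : ℕ} (hd : 2 ≤ d) : entProj d * entProj d = entProj d := by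
  have h0 : (d : ℂ) ≠ 0 := by norm_cast; omega
  ext p q
  simp [entProj, maxEnt, Matrix.mul_apply, Fintype.sum_prod_type]
  split_ifs <;> simp [h0]

theorem entProj_compl_nonneg {d : ℕ} (hd : 2 ≤ d) : 0 ≤ 1 - entProj d := by
  apply nonneg_of_isHermitian_of_mul_self
  · simp [entProj_conjTranspose]
  · simp [mul_sub, sub_mul, entProj_mul_self hd]

theorem partialTrace_entProj {d : ℕ} (a b : Fin d) :
    partialTrace₂ (entProj d) a b = (1 / (d : ℝ) : ℝ) * (1 : Matrix (Fin d) (Fin d) ℂ) a b := by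
  simp [partialTrace₂, entProj, maxEnt, Matrix.one_apply]

theorem partialTrace_entProj_compl {d : ℕ} (a b : Fin d) :
    partialTrace₂ (1 - entProj d) a b =
      ((d : ℝ) - 1 / (d : ℝ) : ℝ) * (1 : Matrix (Fin d) (Fin d) ℂ) a b := by
  have h : partialTrace₂ (1 - entProj d) a b =
      (∑ c : Fin d, (1 : Matrix (Fin d × Fin d) (Fin d × Fin d) ℂ) (a, c) (b, c)) -
        partialTrace₂ (entProj d) a b := by
    simp [partialTrace₂]
  rw [h, partialTrace_entProj]
  simp [Matrix.one_apply]
  split_ifs <;> simp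

end Projections

/-! ### Partial transposes on the two legs. -/

section PairTranspose

variable {A B A' B' Ahat Bhat : Type*}
  [Fintype A] [DecidableEq A] [Fintype B] [DecidableEq B]
  [Fintype A'] [DecidableEq A'] [Fintype B'] [DecidableEq B']
  [Fintype Ahat] [DecidableEq Ahat] [Fintype Bhat] [DecidableEq Bhat]

/-- Partial transpose on the first tensor factor. -/
def partialTranspose₁ (X : Matrix (A × B) (A × B) ℂ) : Matrix (A × B) (A × B) ℂ :=
  Matrix.of fun p q => X (q.1, p.2) (p.1, q.2)

/-- Bob holds the second factor of the leg `A B'` but the first factor of the leg `B A'`. -/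
theorem transposePair_kronecker (X : Matrix (A × B') (A × B') ℂ) (Y : Matrix (B × A') (B × A') ℂ) :
    transposePair (X ⊗ₖ Y) = partialTranspose₂ X ⊗ₖ partialTranspose₁ Y := rfl

theorem partialTranspose₂_one : partialTranspose₂ (1 : Matrix (A × B) (A × B) ℂ) = 1 := by
  ext ⟨a, b⟩ ⟨a', b'⟩
  change (1 : Matrix (A × B) (A × B) ℂ) (a, b') (a', b) = _
  simp [Matrix.one_apply, eq_comm]

theorem partialTranspose₁_one : partialTranspose₁ (1 : Matrix (A × B) (A × B) ℂ) = 1 := by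
  ext ⟨a, b⟩ ⟨a', b'⟩
  change (1 : Matrix (A × B) (A × B) ℂ) (a', b) (a, b') = _
  simp [Matrix.one_apply, eq_comm]

theorem partialTranspose₂_entProj (d : ℕ) :
    partialTranspose₂ (entProj d) = (1 / (d : ℝ)) • flipOp d := rfl

theorem partialTranspose₁_entProj (d : ℕ) :
    partialTranspose₁ (entProj d) = (1 / (d : ℝ)) • flipOp d := by
  ext p q
  change (1 / (d : ℝ)) • (maxEnt (Fin d) (q.1, p.2) (p.1, q.2)) =
    (1 / (d : ℝ)) • (maxEnt (Fin d) (p.1, q.2) (q.1, p.2))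
  simp only [maxEnt, Matrix.of_apply]
  rw [mul_comm]

theorem partialTranspose₂_entProj_compl (d : ℕ) :
    partialTranspose₂ (1 - entProj d) = 1 - (1 / (d : ℝ)) • flipOp d := by
  rw [map_sub, partialTranspose₂_one, partialTranspose₂_entProj]

theorem partialTranspose₁_entProj_compl (d : ℕ) :
    partialTranspose₁ (1 - entProj d) = 1 - (1 / (d : ℝ)) • flipOp d := by
  have : partialTranspose₁ (1 - entProj d) =
    partialTranspose₁ 1 - partialTranspose₁ (entProj d) := rfl
  rw [this, partialTranspose₁_one, partialTranspose₁_entProj]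

/-- The map `W ↦ r Tr[(Wᵀ ⊗ I) Q]ᵀ`. -/
noncomputable def legTest (r : ℝ) (Q : Matrix (((A × B') × (B × A')) × (Ahat × Bhat))
      (((A × B') × (B × A')) × (Ahat × Bhat)) ℂ) :
    Matrix ((A × B') × (B × A')) ((A × B') × (B × A')) ℂ →ₗ[ℝ]
      Matrix (Ahat × Bhat) (Ahat × Bhat) ℂ where
  toFun W := r • (ofChoi Q W)ᵀ
  map_add' X Y := by rw [map_add, Matrix.transpose_add, smul_add]
  map_smul' c X := by
    rw [LinearMap.map_smul_of_tower, Matrix.transpose_smul, smul_comm, RingHom.id_apply]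

theorem legTest_nonneg {r : ℝ} (hr : 0 ≤ r) {Q : Matrix (((A × B') × (B × A')) × (Ahat × Bhat))
      (((A × B') × (B × A')) × (Ahat × Bhat)) ℂ} (hQ : 0 ≤ Q)
    {W : Matrix ((A × B') × (B × A')) ((A × B') × (B × A')) ℂ} (hW : 0 ≤ W) :
    0 ≤ legTest r Q W :=
  nonneg_real_smul (nonneg_transpose (ofChoi_nonneg hQ hW)) hr

theorem partialTranspose_legTest (r : ℝ) (Q : Matrix (((A × B') × (B × A')) × (Ahat × Bhat))
      (((A × B') × (B × A')) × (Ahat × Bhat)) ℂ)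
    (W : Matrix ((A × B') × (B × A')) ((A × B') × (B × A')) ℂ) :
    partialTranspose₂ (legTest r Q W) = legTest r (transposeLegs Q) (transposePair W) := by
  change r • (partialTranspose₂ (ofChoi Q W))ᵀ = _
  rw [partialTranspose_ofChoi]
  rfl

end PairTranspose

/-! ### Passing between Choi operators and the simplified program. -/

section Swap

variable {Ahat Bhat : Type*} [Fintype Ahat] [DecidableEq Ahat] [Fintype Bhat] [DecidableEq Bhat]

/-- The maximally entangled projection across `AB : A'B'` that is the normalized Choi operator of
the swap channel. -/
noncomputable def swapProj (d : ℕ) :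
    Matrix ((Fin d × Fin d) × (Fin d × Fin d)) ((Fin d × Fin d) × (Fin d × Fin d)) ℂ :=
  (entProj d ⊗ₖ entProj d).submatrix (crossLegs _ _ _ _) (crossLegs _ _ _ _)

theorem choi_swapChannel {d : ℕ} (hd : 2 ≤ d) :
    choi (swapChannel d) = ((d : ℝ) ^ 2) • swapProj d := by
  have h0 : (d : ℂ) ≠ 0 := by norm_cast; omega
  ext ⟨⟨a, b⟩, ⟨a', b'⟩⟩ ⟨⟨e, f⟩, ⟨e', f'⟩⟩
  rw [choi_apply]
  change (swapOp d * (Matrix.single (a, b) (e, f) 1 : Matrix _ _ ℂ) * (swapOp d)ᴴ : Matrix _ _ ℂ)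
    (a', b') (e', f') = _
  have h : ((d : ℝ) ^ 2 • swapProj d) ((a, b), (a', b')) ((e, f), (e', f')) =
      maxEnt (Fin d) (a, b') (e, f') * maxEnt (Fin d) (b, a') (f, e') := by
    simp [swapProj, crossLegs, entProj]
    field_simp
  rw [h, swapOp_eq_flipOp, flipOp_conjTranspose, Matrix.mul_assoc, Matrix.mul_apply,
    Finset.sum_eq_single (a, b), Matrix.mul_apply, Finset.sum_eq_single (e, f)]
  · simp only [flipOp_apply, Matrix.single_apply_same, maxEnt, Matrix.of_apply,
      mul_ite, mul_one, mul_zero, ← ite_and, Prod.ext_iff, Prod.fst_swap, Prod.snd_swap]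
    refine if_congr ?_ rfl rfl
    constructor <;> (intro h; obtain ⟨⟨h1, h2⟩, h3, h4⟩ := h; subst h1 h2 h3 h4; simp)
  · intro z _ hz
    simp [hz.symm]
  · simp
  · intro z _ hz
    simp [Matrix.mul_apply, hz.symm]
  · simp

theorem swapProj_nonneg (d : ℕ) : 0 ≤ swapProj d :=
  nonneg_submatrix (nonneg_kronecker (entProj_nonneg d) (entProj_nonneg d)) _

theorem isChannel_swapChannel {d : ℕ} (hd : 2 ≤ d) : IsChannel (swapChannel d) := by
  refine ⟨isCP_iff.2 ?_, fun X => ?_⟩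
  · rw [choi_swapChannel hd]
    exact nonneg_real_smul (swapProj_nonneg d) (by positivity)
  · change (swapOp d * X * (swapOp d)ᴴ).trace = _
    rw [Matrix.trace_mul_cycle, swapOp_eq_flipOp, flipOp_conjTranspose, flipOp_mul_self,
      Matrix.one_mul]

theorem swapProj_mul_self {d : ℕ} (hd : 2 ≤ d) : swapProj d * swapProj d = swapProj d := by
  rw [swapProj, Matrix.submatrix_mul_equiv, ← Matrix.mul_kronecker_mul, entProj_mul_self hd]

theorem swapProj_le_one {d : ℕ} (hd : 2 ≤ d) : swapProj d ≤ 1 := by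
  rw [← sub_nonneg]
  have h : (swapProj d)ᴴ = swapProj d :=
    (nonneg_iff_posSemidef.1 (swapProj_nonneg d)).isHermitian
  apply nonneg_of_isHermitian_of_mul_self
  · simp [h]
  · simp [mul_sub, sub_mul, swapProj_mul_self hd]

theorem trace_swapProj {d : ℕ} (hd : 2 ≤ d) : (swapProj d).trace = 1 := by
  have h0 : (d : ℂ) ≠ 0 := by norm_cast; omega
  have h1 : (swapProj d).trace = (entProj d ⊗ₖ entProj d).trace :=
    Equiv.sum_comp (crossLegs _ _ _ _) fun x => (entProj d ⊗ₖ entProj d) x x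
  have h2 : (entProj d).trace = 1 := by
    simp [entProj, maxEnt, Matrix.trace, Fintype.sum_prod_type, h0]
  rw [h1, Matrix.trace_kronecker, h2, one_mul]

/-- Every positive PPT Choi operator with the right marginal yields a feasible point of the
simplified program, by testing it with the four products of `entProj` and its complement. -/
theorem exists_isSwapFeasible {d : ℕ} (hd : 2 ≤ d) (ρ : Matrix (Ahat × Bhat) (Ahat × Bhat) ℂ)
    {J : Matrix (((Fin d × Ahat) × (Fin d × Bhat)) × (Fin d × Fin d))
      (((Fin d × Ahat) × (Fin d × Bhat)) × (Fin d × Fin d)) ℂ}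
    (hJ : 0 ≤ J) (hppt : 0 ≤ bobTranspose J) (htr : partialTrace₂ J = 1) :
    ∃ K L M N, IsSwapFeasible d K L M N ∧
      (ρ * K).trace.re = ((d : ℝ) ^ 2)⁻¹ * (swapProj d * contractResource ρ J).trace.re := by
  have hd2 : (2 : ℝ) ≤ d := by exact_mod_cast hd
  have h0 : (d : ℝ) ≠ 0 := by linarith
  have h1 : (d : ℝ) + 1 ≠ 0 := by linarith
  have h2 : (d : ℝ) - 1 ≠ 0 := by linarith
  have hm : (0 : ℝ) ≤ 1 / ((d : ℝ) - 1) := one_div_nonneg.2 (by linarith)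
  have hp : (0 : ℝ) ≤ 1 / ((d : ℝ) + 1) := one_div_nonneg.2 (by linarith)
  set Q := J.submatrix (ofLegs (A := Fin d) (B := Fin d) (A' := Fin d) (B' := Fin d)
    (Ahat := Ahat) (Bhat := Bhat)) ofLegs with hQdef
  have hQ : 0 ≤ Q := nonneg_submatrix hJ _
  have hQ' : 0 ≤ transposeLegs Q := nonneg_submatrix hppt ofLegs
  -- The marginal condition on `J` makes the pairing with the identity equal to `d²` times the
  -- identity; this factor normalizes it to `K + L + M + N = 1`.
  have hr : 0 ≤ ((d : ℝ) ^ 2)⁻¹ := by positivity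
  set g := legTest ((d : ℝ) ^ 2)⁻¹ Q with hg
  set g' := legTest ((d : ℝ) ^ 2)⁻¹ (transposeLegs Q) with hg'
  have hT : ∀ W, partialTranspose₂ (g W) = g' (transposePair W) := partialTranspose_legTest _ Q
  have gpos : ∀ {W}, 0 ≤ W → 0 ≤ g W := fun h => legTest_nonneg hr hQ h
  have gpos' : ∀ {W}, 0 ≤ W → 0 ≤ g' W := fun h => legTest_nonneg hr hQ' h
  set Φ := entProj d with hΦ
  set Ψ : Matrix (Fin d × Fin d) (Fin d × Fin d) ℂ := 1 - entProj d with hΨ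
  have hΦ0 := entProj_nonneg d
  have hΦc := entProj_compl_nonneg hd
  have hS := symProj_nonneg d
  have hA := altProj_nonneg d
  have tadd : ∀ X Y : Matrix ((Fin d × Fin d) × (Fin d × Fin d)) _ ℂ,
    transposePair (X + Y) = transposePair X + transposePair Y := fun _ _ => rfl
  have tsmul : ∀ (r : ℝ) (X : Matrix ((Fin d × Fin d) × (Fin d × Fin d)) _ ℂ),
    transposePair (r • X) = r • transposePair X := fun _ _ => rfl
  refine ⟨g (Φ ⊗ₖ Φ), g (Φ ⊗ₖ Ψ), g (Ψ ⊗ₖ Φ), g (Ψ ⊗ₖ Ψ),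
    ⟨gpos (nonneg_kronecker hΦ0 hΦ0), gpos (nonneg_kronecker hΦ0 hΦc),
      gpos (nonneg_kronecker hΦc hΦ0), gpos (nonneg_kronecker hΦc hΦc), ?_, ?_, ?_, ?_, ?_⟩, ?_⟩
  · simp only [← map_smul g, ← map_add g, hT]
    -- The transpose of `Φ + Ψ/(d+1)` is `2/(d+1)` times the symmetric projection, on each leg.
    have key := gpos' (nonneg_real_smul (nonneg_kronecker hS hS)
      (mul_nonneg (mul_nonneg zero_le_four hp) hp))
    refine key.trans_eq (congrArg g' ?_)
    simp only [tadd, tsmul, transposePair_kronecker, hΦ, hΨ, partialTranspose₁_entProj,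
      partialTranspose₂_entProj, partialTranspose₁_entProj_compl, partialTranspose₂_entProj_compl]
    simp only [symProj, sub_kronecker, kronecker_sub, smul_kronecker, kronecker_smul, add_kronecker,
      kronecker_add]
    match_scalars <;> field_simp <;> ring
  · rw [← sub_nonneg]
    simp only [← map_smul g, ← map_add g, hT]
    rw [← map_smul g', ← map_sub g']
    -- On the second leg `Ψ/(d-1) - Φ` enters instead, whose transpose is `2/(d-1)` times the
    -- antisymmetric projection.
    have key := gpos' (nonneg_real_smul (nonneg_kronecker hS hA)
      (mul_nonneg (mul_nonneg zero_le_four hp) hm))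
    refine key.trans_eq (congrArg g' ?_)
    simp only [tadd, tsmul, transposePair_kronecker, hΦ, hΨ, partialTranspose₁_entProj,
      partialTranspose₂_entProj, partialTranspose₁_entProj_compl, partialTranspose₂_entProj_compl]
    simp only [symProj, altProj, sub_kronecker, kronecker_sub, smul_kronecker, kronecker_smul,
      add_kronecker]
    match_scalars <;> field_simp <;> ring
  · rw [← sub_nonneg]
    simp only [← map_smul g, ← map_add g, hT]
    rw [← map_smul g', ← map_sub g']
    have key := gpos' (nonneg_real_smul (nonneg_kronecker hA hS)
      (mul_nonneg (mul_nonneg zero_le_four hp) hm))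
    refine key.trans_eq (congrArg g' ?_)
    simp only [tadd, tsmul, transposePair_kronecker, hΦ, hΨ, partialTranspose₁_entProj,
      partialTranspose₂_entProj, partialTranspose₁_entProj_compl, partialTranspose₂_entProj_compl]
    simp only [symProj, altProj, sub_kronecker, kronecker_sub, smul_kronecker, kronecker_smul,
      kronecker_add]
    match_scalars <;> field_simp <;> ring
  · rw [← sub_nonneg]
    simp only [← map_smul g, ← map_add g, hT]
    rw [← map_smul g', ← map_sub g']
    have key := gpos' (nonneg_real_smul (nonneg_kronecker hA hA)
      (mul_nonneg (mul_nonneg zero_le_four hm) hm))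
    refine key.trans_eq (congrArg g' ?_)
    simp only [tadd, tsmul, transposePair_kronecker, hΦ, hΨ, partialTranspose₁_entProj,
      partialTranspose₂_entProj, partialTranspose₁_entProj_compl, partialTranspose₂_entProj_compl]
    simp only [altProj, sub_kronecker, kronecker_sub, smul_kronecker, kronecker_smul]
    match_scalars <;> field_simp <;> ring
  · have h : Φ ⊗ₖ Φ + Φ ⊗ₖ Ψ + Ψ ⊗ₖ Φ + Ψ ⊗ₖ Ψ = 1 := by
      rw [← Matrix.one_kronecker_one, hΨ, ← hΦ]
      simp only [sub_kronecker, kronecker_sub]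
      abel
    rw [← map_add g, ← map_add g, ← map_add g, h, hg]
    change ((d : ℝ) ^ 2)⁻¹ • (ofChoi Q 1)ᵀ = 1
    rw [hQdef, ofChoi_legs_one J htr]
    have h0' : (d : ℂ) ≠ 0 := by exact_mod_cast h0
    ext x y
    simp only [Matrix.smul_apply, Matrix.transpose_apply, Matrix.one_apply, eq_comm (a := y),
      Fintype.card_fin, smul_eq_mul, Complex.real_smul]
    split_ifs
    · push_cast
      field_simp
    · simp
  · have hWt : (Φ ⊗ₖ Φ)ᵀ = Φ ⊗ₖ Φ := by
      rw [← Matrix.kroneckerMap_transpose, hΦ, entProj_transpose]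
    have h := trace_mul_transpose_ofChoi ρ J (Φ ⊗ₖ Φ)
    rw [hWt] at h
    change (ρ * (((d : ℝ) ^ 2)⁻¹ • (ofChoi Q (Φ ⊗ₖ Φ))ᵀ)).trace.re = _
    rw [Matrix.mul_smul, Matrix.trace_smul, h, Complex.real_smul, Complex.re_ofReal_mul]
    rfl

/-- Every feasible point of the simplified program yields a Choi operator whose contraction with
the resource contains the fraction `Tr[ρ K]` of the swap channel. -/
theorem exists_choi_of_isSwapFeasible {d : ℕ} (hd : 2 ≤ d)
    {ρ : Matrix (Ahat × Bhat) (Ahat × Bhat) ℂ} (hρ : 0 ≤ ρ)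
    {K L M N : Matrix (Ahat × Bhat) (Ahat × Bhat) ℂ} (h : IsSwapFeasible d K L M N) :
    ∃ J : Matrix (((Fin d × Ahat) × (Fin d × Bhat)) × (Fin d × Fin d))
      (((Fin d × Ahat) × (Fin d × Bhat)) × (Fin d × Fin d)) ℂ,
      0 ≤ J ∧ 0 ≤ bobTranspose J ∧ partialTrace₂ J = 1 ∧
      (ρ * K).trace.re • choi (swapChannel d) ≤ contractResource ρ J := by
  have hd2 : (2 : ℝ) ≤ d := by exact_mod_cast hd
  have h0 : (d : ℝ) ≠ 0 := by linarith
  have h1 : (d : ℝ) + 1 ≠ 0 := by linarith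
  have h2 : (d : ℝ) - 1 ≠ 0 := by linarith
  set Φ := entProj d with hΦ
  have hΦ0 := entProj_nonneg d
  have hΦc := entProj_compl_nonneg hd
  have hS := symProj_nonneg d
  have hA := altProj_nonneg d
  -- The leg marginals of `Φ` and `1 - Φ` are `1/d` and `(d² - 1)/d` times the identity. The weights
  -- `d²`, `c₁`, `c₂` give all four terms marginal weight one.
  set c₁ : ℝ := (d : ℝ) ^ 2 / (((d : ℝ) - 1) * ((d : ℝ) + 1)) with hc₁
  set c₂ : ℝ := (d : ℝ) ^ 2 / (((d : ℝ) - 1) * ((d : ℝ) + 1)) ^ 2 with hc₂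
  have hpos : 0 < ((d : ℝ) - 1) * ((d : ℝ) + 1) := mul_pos (by linarith) (by linarith)
  have hc₁0 : 0 ≤ c₁ := by positivity
  have hc₂0 : 0 ≤ c₂ := by positivity
  set Q : Matrix (((Fin d × Fin d) × (Fin d × Fin d)) × (Ahat × Bhat))
      (((Fin d × Fin d) × (Fin d × Fin d)) × (Ahat × Bhat)) ℂ :=
    (d : ℝ) ^ 2 • ((Φ ⊗ₖ Φ) ⊗ₖ Kᵀ) + c₁ • ((Φ ⊗ₖ (1 - Φ)) ⊗ₖ Lᵀ) +
      c₁ • (((1 - Φ) ⊗ₖ Φ) ⊗ₖ Mᵀ) + c₂ • (((1 - Φ) ⊗ₖ (1 - Φ)) ⊗ₖ Nᵀ) with hQ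
  refine ⟨Q.submatrix toLegs toLegs, nonneg_submatrix ?_ _, ?_, ?_, ?_⟩
  · exact add_nonneg (add_nonneg (add_nonneg
      (nonneg_real_smul (nonneg_kronecker (nonneg_kronecker hΦ0 hΦ0)
        (nonneg_transpose h.K_nonneg)) (by positivity))
      (nonneg_real_smul (nonneg_kronecker (nonneg_kronecker hΦ0 hΦc)
        (nonneg_transpose h.L_nonneg)) hc₁0))
      (nonneg_real_smul (nonneg_kronecker (nonneg_kronecker hΦc hΦ0)
        (nonneg_transpose h.M_nonneg)) hc₁0))
      (nonneg_real_smul (nonneg_kronecker (nonneg_kronecker hΦc hΦc)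
        (nonneg_transpose h.N_nonneg)) hc₂0)
  · change 0 ≤ (transposeLegs Q).submatrix toLegs toLegs
    refine nonneg_submatrix ?_ _
    -- Under the transpose, `d Φ` becomes `S - A` and `d (1 - Φ)/(d² - 1)` becomes `S/(d+1) +
    -- A/(d-1)`. Collecting the coefficients of the four products of `S` and `A` reproduces the
    -- constraints exactly.
    have key := add_nonneg (add_nonneg (add_nonneg
      (nonneg_kronecker (nonneg_kronecker hS hS) (nonneg_transpose h.ppt₁))
      (nonneg_kronecker (nonneg_kronecker hS hA)
        (nonneg_transpose (sub_nonneg.2 h.ppt₂))))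
      (nonneg_kronecker (nonneg_kronecker hA hS)
        (nonneg_transpose (sub_nonneg.2 h.ppt₃))))
      (nonneg_kronecker (nonneg_kronecker hA hA)
        (nonneg_transpose (sub_nonneg.2 h.ppt₄)))
    refine key.trans_eq ?_
    have hQt : transposeLegs Q =
      (d : ℝ) ^ 2 • (transposePair (Φ ⊗ₖ Φ) ⊗ₖ (partialTranspose₂ K)ᵀ) +
      c₁ • (transposePair (Φ ⊗ₖ (1 - Φ)) ⊗ₖ (partialTranspose₂ L)ᵀ) +
      c₁ • (transposePair ((1 - Φ) ⊗ₖ Φ) ⊗ₖ (partialTranspose₂ M)ᵀ) +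
      c₂ • (transposePair ((1 - Φ) ⊗ₖ (1 - Φ)) ⊗ₖ (partialTranspose₂ N)ᵀ) := rfl
    rw [hQt]
    simp only [transposePair_kronecker, hΦ, partialTranspose₁_entProj,
      partialTranspose₂_entProj, partialTranspose₁_entProj_compl, partialTranspose₂_entProj_compl,
      symProj, altProj, map_add, LinearMap.map_smul_of_tower, Matrix.transpose_add,
      Matrix.transpose_sub, Matrix.transpose_smul, hc₁, hc₂]
    generalize (partialTranspose₂ K)ᵀ = K'
    generalize (partialTranspose₂ L)ᵀ = L'
    generalize (partialTranspose₂ M)ᵀ = M'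
    generalize (partialTranspose₂ N)ᵀ = N'
    simp only [sub_kronecker, kronecker_sub, smul_kronecker, kronecker_smul, add_kronecker,
      kronecker_add]
    match_scalars <;> field_simp <;> ring
  · have hsum : partialTrace₂ (Q.submatrix (toLegs (A := Fin d) (B := Fin d) (A' := Fin d)
        (B' := Fin d)) toLegs) =
        (d : ℝ) ^ 2 • partialTrace₂ (((Φ ⊗ₖ Φ) ⊗ₖ Kᵀ).submatrix toLegs toLegs) +
        c₁ • partialTrace₂ (((Φ ⊗ₖ (1 - Φ)) ⊗ₖ Lᵀ).submatrix toLegs toLegs) +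
        c₁ • partialTrace₂ ((((1 - Φ) ⊗ₖ Φ) ⊗ₖ Mᵀ).submatrix toLegs toLegs) +
        c₂ • partialTrace₂ ((((1 - Φ) ⊗ₖ (1 - Φ)) ⊗ₖ Nᵀ).submatrix toLegs toLegs) := by
      ext x y
      simp only [partialTrace₂, hQ, Matrix.submatrix_apply, Matrix.add_apply, Matrix.smul_apply,
        Matrix.of_apply, Finset.sum_add_distrib, Finset.smul_sum]
    rw [hsum]
    ext ⟨⟨a, x⟩, ⟨b, y⟩⟩ ⟨⟨a', x'⟩, ⟨b', y'⟩⟩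
    -- The indices are exchanged because `Q` carries the transposes of `K, L, M, N`.
    have hN := congrFun (congrFun h.sum_eq (x', y')) (x, y)
    simp only [Matrix.add_apply] at hN
    simp only [partialTrace_kronecker_legs, Matrix.add_apply, Matrix.smul_apply, Matrix.of_apply,
      hΦ, partialTrace_entProj, partialTrace_entProj_compl, Matrix.transpose_apply,
      Complex.real_smul]
    have hone : (1 : Matrix ((Fin d × Ahat) × (Fin d × Bhat)) _ ℂ) ((a, x), (b, y))
        ((a', x'), (b', y')) = (1 : Matrix (Fin d) (Fin d) ℂ) a a' *
        (1 : Matrix (Fin d) (Fin d) ℂ) b b' *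
        (1 : Matrix (Ahat × Bhat) (Ahat × Bhat) ℂ) (x', y') (x, y) := by
      simp only [Matrix.one_apply, Prod.mk.injEq, mul_ite, mul_one, mul_zero, ← ite_and]
      refine if_congr ?_ rfl rfl
      tauto
    rw [hone, ← hN]
    have h0' : (d : ℂ) ≠ 0 := by exact_mod_cast h0
    have h1' : (d : ℂ) + 1 ≠ 0 := by exact_mod_cast h1
    have h2' : (d : ℂ) - 1 ≠ 0 := by exact_mod_cast h2
    rw [hc₁, hc₂]
    push_cast
    field_simp
    ring
  · have hre : ∀ {X : Matrix (Ahat × Bhat) (Ahat × Bhat) ℂ}, 0 ≤ X →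
        0 ≤ (ρ * X).trace.re ∧ (ρ * X).trace = ((ρ * X).trace.re : ℂ) := fun hX => by
      have := Complex.nonneg_iff.1 (trace_mul_nonneg hρ hX)
      exact ⟨this.1, Complex.ext rfl (by simp [← this.2])⟩
    have hsub : Q.submatrix (toLegs (A := Fin d) (B := Fin d) (A' := Fin d) (B' := Fin d)) toLegs =
        (d : ℝ) ^ 2 • ((Φ ⊗ₖ Φ) ⊗ₖ Kᵀ).submatrix toLegs toLegs +
        c₁ • ((Φ ⊗ₖ (1 - Φ)) ⊗ₖ Lᵀ).submatrix toLegs toLegs +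
        c₁ • (((1 - Φ) ⊗ₖ Φ) ⊗ₖ Mᵀ).submatrix toLegs toLegs +
        c₂ • (((1 - Φ) ⊗ₖ (1 - Φ)) ⊗ₖ Nᵀ).submatrix toLegs toLegs := rfl
    rw [hsub, contractResource_add, contractResource_add, contractResource_add,
      contractResource_smul, contractResource_smul, contractResource_smul, contractResource_smul,
      contractResource_kronecker, contractResource_kronecker, contractResource_kronecker,
      contractResource_kronecker, (hre h.K_nonneg).2, (hre h.L_nonneg).2, (hre h.M_nonneg).2,
      (hre h.N_nonneg).2, Complex.ofReal_re, choi_swapChannel hd, smul_comm, add_assoc, add_assoc]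
    simp only [Complex.coe_smul]
    exact le_add_of_nonneg_right (add_nonneg
      (nonneg_real_smul (nonneg_real_smul (nonneg_submatrix (nonneg_kronecker hΦ0 hΦc) _)
        (hre h.L_nonneg).1) hc₁0)
      (add_nonneg
      (nonneg_real_smul (nonneg_real_smul (nonneg_submatrix (nonneg_kronecker hΦc hΦ0) _)
        (hre h.M_nonneg).1) hc₁0)
      (nonneg_real_smul (nonneg_real_smul (nonneg_submatrix (nonneg_kronecker hΦc hΦc) _)
        (hre h.N_nonneg).1) hc₂0)))

end Swap

/-! ### Matching the optimal values. -/

section Values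

variable {Ahat Bhat : Type*} [Fintype Ahat] [DecidableEq Ahat] [Fintype Bhat] [DecidableEq Bhat]

theorem mul_sInf_eq_one_sub_sSup {c : ℝ} (hc : 0 < c) {S T : Set ℝ} (hS : S.Nonempty)
    (hST : ∀ k ∈ S, ∃ t ∈ T, c * t ≤ 1 - k) (hTS : ∀ t ∈ T, ∃ k ∈ S, 1 - k ≤ c * t)
    (hb : BddAbove S) : c * sInf T = 1 - sSup S := by
  obtain ⟨k₀, hk₀⟩ := hS
  obtain ⟨t₀, ht₀, _⟩ := hST k₀ hk₀
  have hlow : ∀ t ∈ T, (1 - sSup S) / c ≤ t := fun t ht => by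
    obtain ⟨k, hk, h⟩ := hTS t ht
    rw [div_le_iff₀' hc]
    linarith [le_csSup hb hk]
  apply le_antisymm
  · have : sSup S ≤ 1 - c * sInf T := csSup_le ⟨k₀, hk₀⟩ fun k hk => by
      obtain ⟨t, ht, h⟩ := hST k hk
      have := mul_le_mul_of_nonneg_left (csInf_le ⟨_, hlow⟩ ht) hc.le
      linarith
    linarith
  · exact (div_le_iff₀' hc).1 (le_csInf ⟨t₀, ht₀⟩ hlow)

/-- The partial transpose fixes the identity, so every constraint reduces to nonnegativity of a
multiple of the identity. -/
theorem isSwapFeasible_zero {d : ℕ} (hd : 2 ≤ d) :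
    IsSwapFeasible d (0 : Matrix (Ahat × Bhat) (Ahat × Bhat) ℂ) 0 0 1 := by
  have hd2 : (2 : ℝ) ≤ d := by exact_mod_cast hd
  have hm : (0 : ℝ) ≤ 1 / ((d : ℝ) - 1) := one_div_nonneg.2 (by linarith)
  have h1 : (0 : Matrix (Ahat × Bhat) (Ahat × Bhat) ℂ) ≤ 1 :=
    nonneg_iff_posSemidef.2 Matrix.PosSemidef.one
  have hT : ∀ r : ℝ, 0 ≤ r →
      0 ≤ partialTranspose₂ (r • (1 : Matrix (Ahat × Bhat) (Ahat × Bhat) ℂ)) := fun r hr => by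
    rw [LinearMap.map_smul_of_tower, partialTranspose₂_one]
    exact nonneg_real_smul h1 hr
  refine ⟨le_rfl, le_rfl, le_rfl, h1, ?_, ?_, ?_, ?_, by simp⟩
  · simpa only [smul_zero, zero_add] using hT (1 / ((d : ℝ) + 1) ^ 2) (by positivity)
  · simpa only [smul_zero, zero_add, map_zero] using
      nonneg_real_smul (hT (1 / ((d : ℝ) + 1)) (by positivity)) hm
  · simpa only [smul_zero, zero_add, map_zero] using
      nonneg_real_smul (hT (1 / ((d : ℝ) + 1)) (by positivity)) hm
  · simpa only [smul_zero, zero_add, map_zero] using hT (1 / ((d : ℝ) - 1) ^ 2) (by positivity)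

theorem swapObjective_le_one {d : ℕ} {ρ : Matrix (Ahat × Bhat) (Ahat × Bhat) ℂ} (hρ : IsState ρ)
    {K L M N : Matrix (Ahat × Bhat) (Ahat × Bhat) ℂ} (h : IsSwapFeasible d K L M N) :
    (ρ * K).trace.re ≤ 1 := by
  have h1 : 0 ≤ L + M + N := add_nonneg (add_nonneg h.L_nonneg h.M_nonneg) h.N_nonneg
  have h2 : 1 - K = L + M + N := by rw [← h.sum_eq]; abel
  have h3 := (Complex.nonneg_iff.1 (trace_mul_nonneg hρ.1 (h2 ▸ h1))).1
  rw [Matrix.mul_sub, Matrix.mul_one, Matrix.trace_sub, hρ.2] at h3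
  simpa using h3

theorem trace_partialTrace {C D : Type*} [Fintype C] [Fintype D]
    (X : Matrix (C × D) (C × D) ℂ) : (partialTrace₂ X).trace = X.trace := by
  simp [partialTrace₂, Matrix.trace, Fintype.sum_prod_type]

theorem trace_swapProj_mul_choi {d : ℕ} (hd : 2 ≤ d) :
    (swapProj d * choi (swapChannel d)).trace.re = (d : ℝ) ^ 2 := by
  rw [choi_swapChannel hd, Matrix.mul_smul, swapProj_mul_self hd, Matrix.trace_smul,
    trace_swapProj hd, Complex.real_smul, mul_one, Complex.ofReal_re]

theorem pptError_swapChannel {d : ℕ} (hd : 2 ≤ d) {ρ : Matrix (Ahat × Bhat) (Ahat × Bhat) ℂ}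
    (hρ : IsState ρ) (hne : (swapObjective d ρ).Nonempty) (hb : BddAbove (swapObjective d ρ)) :
    pptError (swapChannel d) ρ = 1 - sSup (swapObjective d ρ) := by
  have hd0 : (0 : ℝ) < (d : ℝ) ^ 2 := by
    have : 0 < d := by omega
    positivity
  refine mul_sInf_eq_one_sub_sSup one_half_pos hne ?_ ?_ hb
  · rintro k ⟨K, L, M, N, h, rfl⟩
    obtain ⟨J, hJ, hppt, htr, hle⟩ := exists_choi_of_isSwapFeasible hd hρ.1 h
    have hch : IsChannel (ofChoi J) := isChannel_iff.2 (by rw [choi_ofChoi]; exact ⟨hJ, htr⟩)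
    refine ⟨_, ⟨ofChoi J, hch, isCPPTP_iff.2 (by rwa [choi_ofChoi]), rfl⟩, ?_⟩
    have := diamondDist_le (isChannel_swapChannel hd) (isChannel_simulate hch hρ)
      (swapObjective_le_one hρ h) (by rwa [choi_simulate_ofChoi])
    linarith
  · rintro t ⟨P, hP, hppt, rfl⟩
    have hJ := isChannel_iff.1 hP
    obtain ⟨K, L, M, N, h, htr⟩ := exists_isSwapFeasible hd ρ hJ.1 (isCPPTP_iff.1 hppt) hJ.2
    refine ⟨_, ⟨K, L, M, N, h, rfl⟩, ?_⟩
    have : Nonempty (Fin d) := ⟨⟨0, by omega⟩⟩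
    have := le_diamondDist (isChannel_swapChannel hd) (isChannel_simulate hP hρ)
      (swapProj_nonneg d) (swapProj_le_one hd)
    rw [← choi_simulate_ofChoi, ofChoi_choi] at htr
    rw [Matrix.mul_sub, Matrix.trace_sub, Complex.sub_re, trace_swapProj_mul_choi hd,
      Fintype.card_prod, Fintype.card_fin, Nat.cast_mul, ← sq, mul_sub, ← htr,
      inv_mul_cancel₀ hd0.ne'] at this
    linarith

theorem simValue_swapChannel {d : ℕ} (hd : 2 ≤ d) {ρ : Matrix (Ahat × Bhat) (Ahat × Bhat) ℂ}
    (hρ : IsState ρ) (hne : (swapObjective d ρ).Nonempty) (hb : BddAbove (swapObjective d ρ)) :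
    simValue (swapChannel d) ρ = 1 - sSup (swapObjective d ρ) := by
  have hd0 : (0 : ℝ) < (d : ℝ) ^ 2 := by
    have : 0 < d := by omega
    positivity
  rw [← mul_sInf_eq_one_sub_sSup one_pos hne (T := {μ : ℝ | ∃ Z P,
    IsSimFeasible (swapChannel d) ρ μ Z P}) ?_ ?_ hb, one_mul, simValue]
  · rintro k ⟨K, L, M, N, h, rfl⟩
    obtain ⟨J, hJ, hppt, htr, hle⟩ := exists_choi_of_isSwapFeasible hd hρ.1 h
    have hk := sub_nonneg.2 (swapObjective_le_one hρ h)
    have hS := isChannel_iff.1 (isChannel_swapChannel hd)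
    refine ⟨1 - (ρ * K).trace.re,
      ⟨(1 - (ρ * K).trace.re) • choi (swapChannel d), J, hk, nonneg_real_smul hS.1 hk, hJ, ?_,
        hppt, htr, ?_⟩, (one_mul _).le⟩
    · have : partialTrace₂ ((1 - (ρ * K).trace.re) • choi (swapChannel d)) =
          (1 - (ρ * K).trace.re) • partialTrace₂ (choi (swapChannel d)) := by
        ext x y
        simp [partialTrace₂, Finset.mul_sum]
      rw [this, hS.2]
    · rw [sub_smul, one_smul]
      exact sub_le_sub_left hle _
  · rintro μ ⟨Z, J, h⟩
    obtain ⟨K, L, M, N, hf, htr⟩ := exists_isSwapFeasible hd ρ h.P_nonneg h.ppt h.trace_eq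
    refine ⟨_, ⟨K, L, M, N, hf, rfl⟩, ?_⟩
    -- With `P = swapProj d`, the chain is `Tr[P (Γ - contraction)] ≤ Tr[P Z] ≤ Tr Z ≤ μ d²`.
    have h1 := (Complex.nonneg_iff.1
      (trace_mul_nonneg (swapProj_nonneg d) (sub_nonneg.2 h.le_Z))).1
    have h2 := (Complex.nonneg_iff.1
      (trace_mul_nonneg (sub_nonneg.2 (swapProj_le_one hd)) h.Z_nonneg)).1
    have h3 := trace_re_nonneg (sub_nonneg.2 h.le_mu)
    simp only [Matrix.mul_sub, Matrix.sub_mul, Matrix.one_mul, Matrix.trace_sub, Complex.sub_re,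
      trace_swapProj_mul_choi hd, trace_partialTrace, Matrix.trace_smul, Matrix.trace_one,
      Fintype.card_prod, Fintype.card_fin, Complex.real_smul, Complex.re_ofReal_mul,
      Complex.natCast_re] at h1 h2 h3
    push_cast at h3
    rw [htr, one_mul, sub_le_iff_le_add, ← mul_le_mul_iff_right₀ hd0, mul_add,
      mul_inv_cancel_left₀ hd0.ne']
    nlinarith

end Values

end PPTSim

theorem mainTheorem3 {Ahat Bhat : Type*} [Fintype Ahat] [DecidableEq Ahat]
    [Fintype Bhat] [DecidableEq Bhat] (d : ℕ) (hd : 2 ≤ d)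
    (ρ : Matrix (Ahat × Bhat) (Ahat × Bhat) ℂ) (hρ : PPTSim.IsState ρ) :
    (PPTSim.swapObjective d ρ).Nonempty ∧ BddAbove (PPTSim.swapObjective d ρ) ∧
      PPTSim.pptError (PPTSim.swapChannel d) ρ = 1 - sSup (PPTSim.swapObjective d ρ) ∧
      PPTSim.simValue (PPTSim.swapChannel d) ρ = 1 - sSup (PPTSim.swapObjective d ρ) := by
  have hne : (PPTSim.swapObjective d ρ).Nonempty :=
    ⟨_, 0, 0, 0, 1, PPTSim.isSwapFeasible_zero hd, rfl⟩
  have hb : BddAbove (PPTSim.swapObjective d ρ) :=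
    ⟨1, by rintro k ⟨K, L, M, N, h, rfl⟩; exact PPTSim.swapObjective_le_one hρ h⟩
  exact ⟨hne, hb, PPTSim.pptError_swapChannel hd hρ hne hb,
    PPTSim.simValue_swapChannel hd hρ hne hb⟩
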